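/- Let $D\subset\mathbb R^3$ be a bounded domain with Lipschitz boundary, with surface measure $\sigma$ and outward unit normal $\nu$, and let $\lambda\in\mathbb R$, $|\lambda|>1/2$. Let $\mathcal K_D^*$ be the operator on $L^2(\partial D)$ given by the principal value $$\mathcal K_D^*[\phi](x)=\frac1{4\pi}\,\mathrm{p.v.}\!\int_{\partial D}\frac{\langle x-y,\nu(x)\rangle}{|x-y|^3}\phi(y)\,d\sigma(y).$$ For integers $n\ge 0$ and $-n\le m\le n$ put $$Y_n^m(\theta,\varphi)=(-1)^m\Big[\frac{2n+1}{4\pi}\frac{(n-m)!}{(n+m)!}\Big]^{1/2}e^{im\varphi}P_n^m(\cos\theta),$$ where $P_n^m(x)=\frac{(1-x^2)^{m/2}}{2^n n!}\frac{d^{n+m}}{dx^{n+m}}(x^2-1)^n$ for $m\ge 0$ and $P_n^{-m}=(-1)^m\frac{(n-m)!}{(n+m)!}P_n^m$. In spherical coordinates $y=r(\cos\varphi\sin\theta,\sin\varphi\sin\theta,\cos\theta)$ let $$M_{nmlk}(D)=\int_{\partial D} r^l\,\overline{Y_l^k(\theta,\varphi)}\;(\lambda I-\mathcal K_D^*)^{-1}\Big[\frac{\partial}{\partial\nu}\,r^nY_n^m(\theta,\varphi)\Big]\,d\sigma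 ,$$ and let $\mathbf M_{ln}(D)$ be the $(2l+1)\times(2n+1)$ matrix with entries $(\mathbf M_{ln}(D))_{km}=M_{nmlk}(D)$, $-l\le k\le l$, $-n\le m\le n$. For $\alpha,\beta,\gamma\in\mathbb R$ let $$R(\alpha,\beta,\gamma)=\begin{bmatrix}\cos\alpha&-\sin\alpha&0\\ \sin\alpha&\cos\alpha&0\\0&0&1\end{bmatrix}\begin{bmatrix}\cos\beta&0&-\sin\beta\\0&1&0\\ \sin\beta&0&\cos\beta\end{bmatrix}\begin{bmatrix}\cos\gamma&-\sin\gamma&0\\ \sin\gamma&\cos\gamma&0\\0&0&1\end{bmatrix},$$ and let $\mathbf Q_n=\mathbf Q_n(\alpha,\beta,\gamma)$ be the $(2n+1)\times(2n+1)$ Wigner matrix whose entry in row $m$ and column $m'$ $(-n\le m,m'\le n)$ is $\rho_n^{m',m}=e^{im'\gamma}d_n^{m',m}(\beta)e^{im\alpha}$, where $$d_n^{m',m}(\beta)=[(n+m')!(n-m')!(n+m)!(n-m)!]^{1/2}\sum_{s=\max(0,m-m')}^{\min(n-m',n+m)}\frac{(-1)^{m'+m+s}(\cos\frac\beta2)^{2(n-s)+m-m'}(\sin\frac\beta2)^{2s-m+m'}}{(n+m-s)!\,s!\,(m'-m+s)!\,(n-m'-s)!}.$$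 Let $R$ be a rotation, that is, $R\in SO(3)$, and $D_R=\{Rx : x\in D\}$. Then $R=R(\alpha,\beta,\gamma)$ for some Euler angles $\alpha,\beta,\gamma$. For every such choice of the angles all the matrices $\mathbf Q_n(R)=\mathbf Q_n(\alpha,\beta,\gamma)$ are unitary, and for all $l,n\ge 0$ $$\mathbf M_{ln}(D_R)=\overline{\mathbf Q_l(R)}\,\mathbf M_{ln}(D)\,\mathbf Q_n(R)^t .$$ -/

import Mathlib

open MeasureTheory Filter Topology
open scoped ENNReal InnerProductSpace ComplexConjugate

noncomputable section

/-- Euclidean three-space. -/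
abbrev E3 : Type := EuclideanSpace ℝ (Fin 3)

/-! ### Lipschitz domains, surface measure, outward normal -/

/-- A bounded domain (nonempty connected open set) of `ℝ³` with Lipschitz boundary: near each
boundary point, in suitable orthonormal coordinates, it is the set strictly above the graph of a
Lipschitz function of the first two coordinates. -/
structure IsBoundedLipschitzDomain (D : Set E3) : Prop where
  isOpen : IsOpen D
  isConnected : IsConnected D
  isBounded : Bornology.IsBounded D
  lipschitz_boundary : ∀ p ∈ frontier D,
    ∃ (e : E3 ≃ₗᵢ[ℝ] E3) (L : NNReal) (f : EuclideanSpace ℝ (Fin 2) → ℝ),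
      LipschitzWith L f ∧ ∀ᶠ x in 𝓝 p, x ∈ D ↔ f !₂[e x 0, e x 1] < e x 2

/-- The surface measure `dσ` on `∂D`: two-dimensional Hausdorff measure, normalised so that it is
the area on planes, restricted to `∂D`. -/
def surfaceMeasure (D : Set E3) : Measure E3 :=
  (Measure.euclideanHausdorffMeasure 2 : Measure E3).restrict (frontier D)

/-- `v` is the outward unit normal to `∂D` at `x`: in the blow-up at `x`, the set `D` fills the
open half space `⟪·, v⟫ < 0` and misses the open half space `⟪·, v⟫ > 0`. There is at most one such
`v`; on a Lipschitz boundary it exists wherever the graph function is differentiable. -/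
def IsOutwardUnitNormal (D : Set E3) (x v : E3) : Prop :=
  ‖v‖ = 1 ∧ ∀ ε : ℝ, 0 < ε → ∀ᶠ y in 𝓝 x,
    (⟪y - x, v⟫_ℝ < -(ε * ‖y - x‖) → y ∈ D) ∧ (ε * ‖y - x‖ < ⟪y - x, v⟫_ℝ → y ∉ D)

open Classical in
/-- The outward unit normal field `ν` (zero where there is no normal). -/
def outwardNormal (D : Set E3) (x : E3) : E3 :=
  if h : ∃ v, IsOutwardUnitNormal D x v then h.choose else 0

/-! ### The adjoint Neumann–Poincaré operator -/

/-- The space `L²(∂D)` of complex-valued functions. -/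
abbrev L2Boundary (D : Set E3) : Type := Lp ℂ 2 (surfaceMeasure D)

/-- `(1/4π) ∫_{y ∈ ∂D, |x - y| > ε} ⟨x - y, ν(x)⟩ / |x - y|³ φ(y) dσ(y)`. -/
def truncatedNPAdjoint (D : Set E3) (ε : ℝ) (φ : E3 → ℂ) (x : E3) : ℂ :=
  (1 / (4 * Real.pi) : ℂ) * ∫ y in {y : E3 | ε < ‖x - y‖},
    ((⟪x - y, outwardNormal D x⟫_ℝ / ‖x - y‖ ^ 3 : ℝ) : ℂ) * φ y ∂(surfaceMeasure D)

/-- `T` is the operator `K*_D` on `L²(∂D)`: for every `φ`, the principal value of the singular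
integral exists and equals `T φ` at almost every point of `∂D`. At most one `T` has this
property. -/
def IsNPAdjoint (D : Set E3) (T : L2Boundary D →L[ℂ] L2Boundary D) : Prop :=
  ∀ φ : L2Boundary D, ∀ᵐ x ∂(surfaceMeasure D),
    Tendsto (fun ε : ℝ => truncatedNPAdjoint D ε φ x) (𝓝[>] 0) (𝓝 (T φ x))

open Classical in
/-- The operator `K*_D` on `L²(∂D)` (zero if the principal values do not define an operator). -/
def npAdjoint (D : Set E3) : L2Boundary D →L[ℂ] L2Boundary D :=
  if h : ∃ T, IsNPAdjoint D T then h.choose else 0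

/-- The operator `(λ I - K*_D)⁻¹` on `L²(∂D)`. -/
def npResolvent (lam : ℝ) (D : Set E3) : L2Boundary D →L[ℂ] L2Boundary D :=
  Ring.inverse ((lam : ℂ) • (1 : L2Boundary D →L[ℂ] L2Boundary D) - npAdjoint D)

/-! ### Spherical harmonics -/

/-- The associated Legendre function of degree `n` and order `m ≥ 0`, without the
Condon–Shortley phase:
`(1 - x²)^{m/2} / (2ⁿ n!) · dⁿ⁺ᵐ/dxⁿ⁺ᵐ (x² - 1)ⁿ`. -/
def assocLegendreNat (n m : ℕ) (x : ℝ) : ℝ :=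
  Real.sqrt (1 - x ^ 2) ^ m / (2 ^ n * n.factorial) *
    (Polynomial.derivative^[n + m] ((Polynomial.X ^ 2 - 1 : Polynomial ℝ) ^ n)).eval x

/-- The associated Legendre function of degree `n` and integer order `m`, extended to negative
orders by `P_n^{-m} = (-1)^m (n-m)!/(n+m)! P_n^m`. -/
def assocLegendre (n : ℕ) (m : ℤ) (x : ℝ) : ℝ :=
  if 0 ≤ m then assocLegendreNat n m.toNat x
  else (-1) ^ m.natAbs * ((n - m.natAbs).factorial / (n + m.natAbs).factorial : ℝ) *
    assocLegendreNat n m.natAbs x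

/-- The complex spherical harmonic `Y_n^m(θ, φ)`, for `-n ≤ m ≤ n`. -/
def sphericalHarmonic (n : ℕ) (m : ℤ) (θ φ : ℝ) : ℂ :=
  (-1 : ℂ) ^ m *
    (Real.sqrt ((2 * n + 1) / (4 * Real.pi) *
      ((((n : ℤ) - m).toNat.factorial : ℝ) / (((n : ℤ) + m).toNat.factorial : ℝ))) : ℂ) *
    Complex.exp (Complex.I * m * φ) * (assocLegendre n m (Real.cos θ) : ℂ)

/-- The polar angle `θ ∈ [0, π]` of `x = r (cos φ sin θ, sin φ sin θ, cos θ)`. -/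
def polarAngle (x : E3) : ℝ := Real.arccos (x 2 / ‖x‖)

/-- The azimuth `φ ∈ (-π, π]` of `x = r (cos φ sin θ, sin φ sin θ, cos θ)`. -/
def azimuth (x : E3) : ℝ := Complex.arg ⟨x 0, x 1⟩

/-- The homogeneous harmonic polynomial `r^n Y_n^m(θ, φ)` as a function on `ℝ³`. -/
def solidHarmonic (n : ℕ) (m : ℤ) (x : E3) : ℂ :=
  ((‖x‖ ^ n : ℝ) : ℂ) * sphericalHarmonic n m (polarAngle x) (azimuth x)

/-! ### Contracted generalised polarisation tensors -/

/-- The normal derivative `∂/∂ν (r^n Y_n^m)` on `∂D`. -/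
def solidHarmonicNormalDeriv (D : Set E3) (n : ℕ) (m : ℤ) (x : E3) : ℂ :=
  fderiv ℝ (solidHarmonic n m) x (outwardNormal D x)

open Classical in
/-- The class in `L²(∂D)` of a square integrable function (zero for other functions). -/
def toL2Boundary (D : Set E3) (g : E3 → ℂ) : L2Boundary D :=
  if h : MemLp g 2 (surfaceMeasure D) then h.toLp g else 0

/-- The contracted generalised polarisation tensor `M_{nmlk}(λ, D)`. -/
def cgpt (lam : ℝ) (D : Set E3) (n : ℕ) (m : ℤ) (l : ℕ) (k : ℤ) : ℂ :=
  ∫ y, conj (solidHarmonic l k y) *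
    npResolvent lam D (toL2Boundary D (solidHarmonicNormalDeriv D n m)) y ∂(surfaceMeasure D)

/-- The orders `-n ≤ m ≤ n` belonging to the degree `n`. -/
abbrev Orders (n : ℕ) : Type := ↥(Finset.Icc (-(n : ℤ)) (n : ℤ))

/-- The CGPT matrix `M_{ln}(D)`, of size `(2l+1) × (2n+1)`, with entries
`(M_{ln})_{km} = M_{nmlk}`. -/
def cgptMatrix (lam : ℝ) (D : Set E3) (l n : ℕ) : Matrix (Orders l) (Orders n) ℂ :=
  Matrix.of fun k m => cgpt lam D n m l k

/-! ### Rotations, Euler angles and the Wigner matrix -/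

/-- The image `D_R = {R x | x ∈ D}`. -/
def rotatedSet (R : Matrix (Fin 3) (Fin 3) ℝ) (D : Set E3) : Set E3 :=
  (fun x : E3 => WithLp.toLp 2 (R.mulVec x.ofLp)) '' D

/-- The elementary rotation in the first two coordinates. -/
def rotZ (t : ℝ) : Matrix (Fin 3) (Fin 3) ℝ :=
  !![Real.cos t, -Real.sin t, 0; Real.sin t, Real.cos t, 0; 0, 0, 1]

/-- The elementary rotation in the first and the third coordinate. -/
def rotY (t : ℝ) : Matrix (Fin 3) (Fin 3) ℝ :=
  !![Real.cos t, 0, -Real.sin t; 0, 1, 0; Real.sin t, 0, Real.cos t]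

/-- The rotation with Euler angles `α, β, γ`: by `α` about the third axis, then by `β` about the
new second axis, then by `γ` about the new third axis. Rotations about successively moved axes
multiply from left to right; the signs of the angles are those of `rotZ` and `rotY`. -/
def eulerRotation (α β γ : ℝ) : Matrix (Fin 3) (Fin 3) ℝ := rotZ α * rotY β * rotZ γ

/-- `d_n^{m',m}(β)`, for `-n ≤ m', m ≤ n`. In the range of summation all the integers to which
`Int.toNat` is applied are nonnegative. -/
def wignerSmallD (n : ℕ) (m' m : ℤ) (β : ℝ) : ℝ :=
  Real.sqrt (((n + m').toNat.factorial : ℝ) * ((n - m').toNat.factorial : ℝ) *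
      ((n + m).toNat.factorial : ℝ) * ((n - m).toNat.factorial : ℝ)) *
    ∑ s ∈ Finset.Icc (max 0 (m - m')) (min (n - m') (n + m)),
      (-1 : ℝ) ^ (m' + m + s) * Real.cos (β / 2) ^ (2 * (n - s) + m - m').toNat *
          Real.sin (β / 2) ^ (2 * s - m + m').toNat /
        (((n + m - s).toNat.factorial : ℝ) * (s.toNat.factorial : ℝ) *
          ((m' - m + s).toNat.factorial : ℝ) * ((n - m' - s).toNat.factorial : ℝ))

/-- `ρ_n^{m',m} = e^{i m' γ} d_n^{m',m}(β) e^{i m α}`. -/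
def wignerRho (n : ℕ) (m' m : ℤ) (α β γ : ℝ) : ℂ :=
  Complex.exp (Complex.I * m' * γ) * (wignerSmallD n m' m β : ℂ) *
    Complex.exp (Complex.I * m * α)

/-- The Wigner matrix `Q_n`, whose row `m` and column `m'` entry is `ρ_n^{m',m}`. -/
def wignerQ (n : ℕ) (α β γ : ℝ) : Matrix (Orders n) (Orders n) ℂ :=
  Matrix.of fun m m' => wignerRho n m' m α β γ

end

/-! ### Outward normals -/

/-! The proof joins two independent facts. Geometry: a linear isometry `e` carries surface measure,
normals and the kernel of K* on ∂D to those on ∂(e D). So φ ↦ φ ∘ e conjugates the operator on ∂(e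
D) to the one on ∂D, and the resolvents likewise (`boundaryConj_npResolvent`). Representation
theory: the solid harmonics of degree n, weighted by normalised monomials in (u, v), have as
generating function the n-th power of a quadratic form attached to x
(`sum_solidHarmonic_mul_spinMonomial`). Rotating x amounts to an SU(2) substitution in (u, v) by
half angles (`solidForm_rotZ`, `solidForm_rotY`). The Wigner matrix records the action of this
substitution on the monomials (`spinMonomial_rotate`, `spinMonomial_phase`), and comparing
coefficients gives `solidHarmonic_eulerRotation`. Its unitarity comes from composing the rotation by
β with its inverse. Changing variables in the integral and expanding both harmonics (`cgpt_image`)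
gives the matrix identity; the conjugate on the left comes from the conjugated test harmonic. -/

theorem IsOutwardUnitNormal.unique {D : Set E3} {x v w : E3} (hv : IsOutwardUnitNormal D x v)
    (hw : IsOutwardUnitNormal D x w) : v = w := by
  by_contra hne
  have hvv : ⟪v, v⟫_ℝ = 1 := by rw [real_inner_self_eq_norm_sq, hv.1, one_pow]
  have hww : ⟪w, w⟫_ℝ = 1 := by rw [real_inner_self_eq_norm_sq, hw.1, one_pow]
  have hlt : ⟪v, w⟫_ℝ < 1 := by
    refine lt_of_le_of_ne ?_ fun h => hne ?_
    · simpa [hv.1, hw.1] using real_inner_le_norm v w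
    · exact (inner_eq_one_iff_of_norm_eq_one hv.1 hw.1).1 h
  have hd : 0 < ‖w - v‖ := norm_pos_iff.2 (sub_ne_zero.2 (Ne.symm hne))
  -- Along x + t(w - v) with small t > 0, the normal v puts the point in D and w puts it outside.
  -- Both cone conditions hold because ⟪w - v, w⟫ and -⟪w - v, v⟫ equal 1 - ⟪v, w⟫, which exceeds
  -- ε‖w - v‖.
  obtain ⟨ε, hε, hεd⟩ : ∃ ε : ℝ, 0 < ε ∧ ε * ‖w - v‖ < 1 - ⟪v, w⟫_ℝ := by
    refine ⟨(1 - ⟪v, w⟫_ℝ) / 2 / ‖w - v‖, by have := sub_pos.2 hlt; positivity, ?_⟩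
    rw [div_mul_cancel₀ _ hd.ne']
    linarith
  have hpath : Tendsto (fun t : ℝ => x + t • (w - v)) (𝓝[>] 0) (𝓝 x) := by
    have : Continuous fun t : ℝ => x + t • (w - v) := by fun_prop
    simpa using (this.tendsto 0).mono_left nhdsWithin_le_nhds
  obtain ⟨t, ⟨⟨h1, -⟩, -, h2⟩, ht⟩ := ((hpath.eventually ((hv.2 ε hε).and (hw.2 ε hε))).and
    self_mem_nhdsWithin).exists
  have ht : 0 < t := ht
  have hn : ‖x + t • (w - v) - x‖ = t * ‖w - v‖ := by
    rw [add_sub_cancel_left, norm_smul, Real.norm_of_nonneg ht.le]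
  refine h2 ?_ (h1 ?_)
  · rw [hn, add_sub_cancel_left, inner_smul_left, inner_sub_left, hww, RCLike.conj_to_real]
    nlinarith
  · rw [hn, add_sub_cancel_left, inner_smul_left, inner_sub_left, hvv, real_inner_comm,
      RCLike.conj_to_real]
    nlinarith

theorem IsOutwardUnitNormal.outwardNormal_eq {D : Set E3} {x v : E3}
    (h : IsOutwardUnitNormal D x v) : outwardNormal D x = v := by
  have hex : ∃ v, IsOutwardUnitNormal D x v := ⟨v, h⟩
  rw [outwardNormal, dif_pos hex]
  exact hex.choose_spec.unique h

theorem outwardNormal_eq_zero {D : Set E3} {x : E3} (h : ¬ ∃ v, IsOutwardUnitNormal D x v) :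
    outwardNormal D x = 0 := by
  rw [outwardNormal, dif_neg h]

theorem norm_outwardNormal_le (D : Set E3) (x : E3) : ‖outwardNormal D x‖ ≤ 1 := by
  by_cases h : ∃ v, IsOutwardUnitNormal D x v
  · obtain ⟨v, hv⟩ := h
    rw [hv.outwardNormal_eq, hv.1]
  · simp [outwardNormal_eq_zero h]

theorem IsOutwardUnitNormal.image {D : Set E3} {x v : E3} (h : IsOutwardUnitNormal D x v)
    (e : E3 ≃ₗᵢ[ℝ] E3) : IsOutwardUnitNormal (e '' D) (e x) (e v) := by
  refine ⟨by rw [e.norm_map, h.1], fun ε hε => ?_⟩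
  have hs : Tendsto e.symm (𝓝 (e x)) (𝓝 x) := by
    simpa using e.symm.continuous.tendsto (e x)
  filter_upwards [hs.eventually (h.2 ε hε)] with y hy
  obtain ⟨z, rfl⟩ := e.surjective y
  simpa [← map_sub, e.injective.mem_set_image] using hy

theorem isOutwardUnitNormal_image_iff (D : Set E3) (x v : E3) (e : E3 ≃ₗᵢ[ℝ] E3) :
    IsOutwardUnitNormal (e '' D) (e x) (e v) ↔ IsOutwardUnitNormal D x v := by
  refine ⟨fun h => ?_, fun h => h.image e⟩
  simpa [Set.image_image] using h.image e.symm

theorem outwardNormal_image (D : Set E3) (x : E3) (e : E3 ≃ₗᵢ[ℝ] E3) :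
    outwardNormal (e '' D) (e x) = e (outwardNormal D x) := by
  by_cases h : ∃ v, IsOutwardUnitNormal D x v
  · obtain ⟨v, hv⟩ := h
    rw [hv.outwardNormal_eq, (hv.image e).outwardNormal_eq]
  · rw [outwardNormal_eq_zero h, map_zero, outwardNormal_eq_zero]
    rintro ⟨w, hw⟩
    obtain ⟨v, rfl⟩ := e.surjective w
    exact h ⟨v, (isOutwardUnitNormal_image_iff D x v e).1 hw⟩

/-- The graph of the partial map sending a boundary point to its outward unit normal is Borel. -/
theorem measurableSet_isOutwardUnitNormal (D : Set E3) :
    MeasurableSet {p : E3 × E3 | IsOutwardUnitNormal D p.1 p.2} := by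
  -- For fixed y the condition on p says that open conditions imply statements free of p, so it is
  -- closed. This survives the uncountable intersection over y; only ε and δ then need countable
  -- ranges.
  let good (ε δ : ℝ) : Set (E3 × E3) := {p | ∀ y, ‖y - p.1‖ < δ →
    (⟪y - p.1, p.2⟫_ℝ < -(ε * ‖y - p.1‖) → y ∈ D) ∧ (ε * ‖y - p.1‖ < ⟪y - p.1, p.2⟫_ℝ → y ∉ D)}
  have hclosed (ε δ : ℝ) : IsClosed (good ε δ) := by
    have : good ε δ = ⋂ y : E3, ({p | ‖y - p.1‖ < δ}ᶜ ∪
        (({p | ⟪y - p.1, p.2⟫_ℝ < -(ε * ‖y - p.1‖)}ᶜ ∪ {_p | y ∈ D}) ∩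
          ({p | ε * ‖y - p.1‖ < ⟪y - p.1, p.2⟫_ℝ}ᶜ ∪ {_p | y ∉ D}))) := by
      ext p
      simp only [good, Set.mem_iInter, Set.mem_union, Set.mem_inter_iff, Set.mem_compl_iff,
        Set.mem_ofPred_eq]
      exact forall_congr' fun y => by tauto
    rw [this]
    refine isClosed_iInter fun y => IsClosed.union ?_ (IsClosed.inter ?_ ?_)
    · exact (isOpen_lt (by fun_prop) (by fun_prop)).isClosed_compl
    · exact (isOpen_lt (by fun_prop) (by fun_prop)).isClosed_compl.union isClosed_const
    · exact (isOpen_lt (by fun_prop) (by fun_prop)).isClosed_compl.union isClosed_const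
  have heq : {p : E3 × E3 | IsOutwardUnitNormal D p.1 p.2} = {p | ‖p.2‖ = 1} ∩
      ⋂ i : ℕ, ⋃ j : ℕ, good (1 / (i + 1)) (1 / (j + 1)) := by
    ext p
    simp only [IsOutwardUnitNormal, Set.mem_ofPred_eq, Set.mem_inter_iff, Set.mem_iInter,
      Set.mem_iUnion, good]
    refine and_congr_right fun _ => ⟨fun h i => ?_, fun h ε hε => ?_⟩
    · obtain ⟨δ, hδ, hb⟩ := Metric.eventually_nhds_iff.1 (h (1 / (i + 1)) (by positivity))
      obtain ⟨j, hj⟩ := exists_nat_one_div_lt hδ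
      exact ⟨j, fun y hy => hb (by rw [dist_eq_norm]; exact hy.trans hj)⟩
    · obtain ⟨i, hi⟩ := exists_nat_one_div_lt hε
      obtain ⟨j, hj⟩ := h i
      refine Metric.eventually_nhds_iff.2 ⟨1 / (j + 1), by positivity, fun y hy => ?_⟩
      obtain ⟨h1, h2⟩ := hj y (by rwa [dist_eq_norm] at hy)
      have hle : 1 / ((i : ℝ) + 1) * ‖y - p.1‖ ≤ ε * ‖y - p.1‖ := by gcongr
      exact ⟨fun h => h1 (by linarith), fun h => h2 (by linarith)⟩
  rw [heq]
  refine MeasurableSet.inter ?_ ?_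
  · exact (isClosed_eq (by fun_prop) (by fun_prop)).measurableSet
  · exact MeasurableSet.iInter fun i => MeasurableSet.iUnion fun j => (hclosed _ _).measurableSet

/-- The preimage of a Borel set is, up to the set without normals, a projection of a Borel part of
the graph. Uniqueness of the normal makes that projection injective, so its image is Borel by
Lusin–Souslin. -/
theorem measurable_outwardNormal (D : Set E3) : Measurable (outwardNormal D) := by
  have hG := measurableSet_isOutwardUnitNormal D
  have himg (s : Set E3) (hs : MeasurableSet s) :
      MeasurableSet {x | ∃ v ∈ s, IsOutwardUnitNormal D x v} := by
    have : {x | ∃ v ∈ s, IsOutwardUnitNormal D x v} =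
        Prod.fst '' ({p : E3 × E3 | IsOutwardUnitNormal D p.1 p.2} ∩ Prod.snd ⁻¹' s) := by
      ext x
      simp only [Set.mem_ofPred_eq, Set.mem_image, Set.mem_inter_iff, Set.mem_preimage, Prod.exists]
      constructor
      · rintro ⟨v, hv, h⟩
        exact ⟨x, v, ⟨h, hv⟩, rfl⟩
      · rintro ⟨_, v, ⟨h, hv⟩, rfl⟩
        exact ⟨v, hv, h⟩
    rw [this]
    refine (hG.inter (measurable_snd hs)).image_of_measurable_injOn measurable_fst ?_
    rintro ⟨x, v⟩ ⟨hv, -⟩ ⟨y, w⟩ ⟨hw, -⟩ (rfl : x = y)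
    exact Prod.ext rfl (hv.unique hw)
  intro s hs
  have : outwardNormal D ⁻¹' s = {x | ∃ v ∈ s, IsOutwardUnitNormal D x v} ∪
      ({x | ∃ v ∈ Set.univ, IsOutwardUnitNormal D x v}ᶜ ∩ {_x | (0 : E3) ∈ s}) := by
    ext x
    simp only [Set.mem_preimage, Set.mem_union, Set.mem_ofPred_eq, Set.mem_inter_iff,
      Set.mem_compl_iff, Set.mem_univ, true_and]
    by_cases h : ∃ v, IsOutwardUnitNormal D x v
    · obtain ⟨v, hv⟩ := h
      rw [hv.outwardNormal_eq]
      refine ⟨fun h => Or.inl ⟨v, h, hv⟩, ?_⟩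
      rintro (⟨w, hw, h⟩ | ⟨h, -⟩)
      · rwa [hv.unique h]
      · exact absurd ⟨v, hv⟩ h
    · rw [outwardNormal_eq_zero h]
      refine ⟨fun h0 => Or.inr ⟨h, h0⟩, ?_⟩
      rintro (⟨w, -, hw⟩ | ⟨-, h0⟩)
      · exact absurd ⟨w, hw⟩ h
      · exact h0
  rw [this]
  exact (himg s hs).union ((himg _ .univ).compl.inter (.const _))

/-! ### The surface measure of a bounded Lipschitz domain -/

/-- A point of the frontier near which `D` is the region above a continuous graph lies on the
graph. -/
theorem eq_of_mem_frontier_of_eventually_iff {X : Type*} [TopologicalSpace X] {D : Set X}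
    (hD : IsOpen D) {a b : X → ℝ} (ha : Continuous a) (hb : Continuous b) {x : X}
    (hx : x ∈ frontier D) (h : ∀ᶠ y in 𝓝 x, y ∈ D ↔ a y < b y) : a x = b x := by
  rw [hD.frontier_eq] at hx
  refine le_antisymm ?_ (not_lt.1 fun hlt => hx.2 (h.self_of_nhds.2 hlt))
  by_contra! hlt
  have hev : ∀ᶠ y in 𝓝 x, b y < a y := hb.continuousAt.eventually_lt ha.continuousAt hlt
  obtain ⟨y, hyD, hy, hy'⟩ := ((mem_closure_iff_frequently.1 hx.1).and_eventually
    (hev.and h)).exists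
  exact lt_asymm hy (hy'.1 hyD)

theorem lipschitzWith_graph {L : NNReal} {f : EuclideanSpace ℝ (Fin 2) → ℝ}
    (hf : LipschitzWith L f) :
    LipschitzWith (1 + L) fun p : EuclideanSpace ℝ (Fin 2) => (!₂[p 0, p 1, f p] : E3) := by
  refine LipschitzWith.of_dist_le_mul fun p q => ?_
  have h := hf.dist_le_mul p q
  rw [Real.dist_eq] at h
  have h2 : |f p - f q| ^ 2 ≤ (L * dist p q) ^ 2 := by gcongr
  rw [EuclideanSpace.dist_eq]
  refine Real.sqrt_le_iff.2 ⟨by positivity, ?_⟩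
  have hpq : (p 0 - q 0) ^ 2 + (p 1 - q 1) ^ 2 = dist p q ^ 2 := by
    rw [EuclideanSpace.dist_eq, Real.sq_sqrt (by positivity)]
    simp [Fin.sum_univ_two, Real.dist_eq]
  simp only [Fin.sum_univ_three, Real.dist_eq, sq_abs] at h2 ⊢
  simp only [Matrix.cons_val_zero, Matrix.cons_val_one, Matrix.cons_val]
  rw [hpq]
  have : 0 ≤ (L : ℝ) * dist p q ^ 2 := by positivity
  push_cast
  nlinarith

theorem hausdorffMeasure_image_lt_top {L : NNReal} {F : EuclideanSpace ℝ (Fin 2) → E3}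
    (hF : LipschitzWith L F) {s : Set (EuclideanSpace ℝ (Fin 2))} (hs : Bornology.IsBounded s) :
    (Measure.euclideanHausdorffMeasure 2 : Measure E3) (F '' s) < ∞ := by
  have hs' : (μH[(2 : ℕ)] : Measure (EuclideanSpace ℝ (Fin 2))) s < ∞ := hs.measure_lt_top
  rw [Measure.euclideanHausdorffMeasure_def, Measure.smul_apply]
  refine ENNReal.mul_lt_top ENNReal.coe_lt_top ((hF.hausdorffMeasure_image_le ?_ s).trans_lt ?_)
  · positivity
  · exact ENNReal.mul_lt_top (ENNReal.rpow_lt_top_of_nonneg (by positivity) ENNReal.coe_ne_top) hs'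

theorem IsBoundedLipschitzDomain.isCompact_frontier {D : Set E3}
    (hD : IsBoundedLipschitzDomain D) : IsCompact (frontier D) :=
  Metric.isCompact_of_isClosed_isBounded isClosed_frontier
    (hD.isBounded.closure.subset frontier_subset_closure)

/-- By compactness finiteness is local, and locally the boundary lies in a Lipschitz image of a
bounded planar set. -/
theorem IsBoundedLipschitzDomain.isFiniteMeasure_surfaceMeasure {D : Set E3}
    (hD : IsBoundedLipschitzDomain D) : IsFiniteMeasure (surfaceMeasure D) := by
  refine ⟨?_⟩
  rw [surfaceMeasure, Measure.restrict_apply_univ]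
  refine hD.isCompact_frontier.measure_lt_top_of_nhdsWithin fun p hp => ?_
  obtain ⟨e, L, f, hf, hloc⟩ := hD.lipschitz_boundary p hp
  obtain ⟨U, hU, hUo, hpU⟩ := eventually_nhds_iff.1 hloc
  have hN : U ∩ Metric.ball p 1 ∈ 𝓝 p :=
    inter_mem (hUo.mem_nhds hpU) (Metric.ball_mem_nhds p one_pos)
  let proj : E3 → EuclideanSpace ℝ (Fin 2) := fun x => !₂[e x 0, e x 1]
  have hproj : Continuous proj := by
    refine (PiLp.continuous_toLp 2 _).comp (continuous_pi fun i => ?_)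
    fin_cases i <;> simp <;> fun_prop
  let F : EuclideanSpace ℝ (Fin 2) → E3 := fun q => e.symm !₂[q 0, q 1, f q]
  have hF := e.symm.lipschitz.comp (lipschitzWith_graph hf)
  have hbd : Bornology.IsBounded (proj '' Metric.ball p 1) :=
    (((isCompact_closedBall p 1).image hproj).isBounded).subset
      (Set.image_mono Metric.ball_subset_closedBall)
  refine ⟨frontier D ∩ (U ∩ Metric.ball p 1), inter_mem_nhdsWithin _ hN, ?_⟩
  refine (measure_mono ?_).trans_lt (hausdorffMeasure_image_lt_top hF hbd)
  rintro x ⟨hx, hxU, hxb⟩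
  refine ⟨proj x, ⟨x, hxb, rfl⟩, ?_⟩
  have heq : f (proj x) = e x 2 :=
    eq_of_mem_frontier_of_eventually_iff hD.isOpen (hf.continuous.comp hproj) (by fun_prop) hx
      (eventually_nhds_iff.2 ⟨U, hU, hUo, hxU⟩)
  change e.symm !₂[proj x 0, proj x 1, f (proj x)] = x
  rw [heq, LinearIsometryEquiv.symm_apply_eq]
  ext i
  fin_cases i <;> simp [proj]

/-! ### The adjoint Neumann–Poincaré operator under linear isometries -/

theorem measurePreserving_surfaceMeasure (D : Set E3) (e : E3 ≃ₗᵢ[ℝ] E3) :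
    MeasurePreserving e (surfaceMeasure D) (surfaceMeasure (e '' D)) := by
  have h := (e.toIsometryEquiv.measurePreserving_euclideanHausdorffMeasure 2).restrict_image_emb
    e.toHomeomorph.measurableEmbedding (frontier D)
  have hfr : e '' frontier D = frontier (e '' D) := e.toHomeomorph.image_frontier D
  rw [surfaceMeasure, surfaceMeasure, ← hfr]
  exact h

theorem measurePreserving_surfaceMeasure_symm (D : Set E3) (e : E3 ≃ₗᵢ[ℝ] E3) :
    MeasurePreserving e.symm (surfaceMeasure (e '' D)) (surfaceMeasure D) :=
  (measurePreserving_surfaceMeasure D e).symm e.toHomeomorph.toMeasurableEquiv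

/-- The kernel involves only norms and inner products, and `e` maps normals to normals, so this is a
change of variables. -/
theorem truncatedNPAdjoint_image (D : Set E3) (e : E3 ≃ₗᵢ[ℝ] E3) (ε : ℝ) (φ : E3 → ℂ) (x : E3) :
    truncatedNPAdjoint (e '' D) ε φ (e x) = truncatedNPAdjoint D ε (φ ∘ e) x := by
  rw [truncatedNPAdjoint, truncatedNPAdjoint, ← (measurePreserving_surfaceMeasure D
    e).setIntegral_preimage_emb e.toHomeomorph.measurableEmbedding]
  simp only [Set.preimage_ofPred_eq, ← map_sub, e.norm_map, outwardNormal_image, e.inner_map_map,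
    Function.comp_apply]

theorem truncatedNPAdjoint_congr_ae (D : Set E3) (ε : ℝ) {φ ψ : E3 → ℂ}
    (h : φ =ᵐ[surfaceMeasure D] ψ) (x : E3) :
    truncatedNPAdjoint D ε φ x = truncatedNPAdjoint D ε ψ x := by
  rw [truncatedNPAdjoint, truncatedNPAdjoint]
  congr 1
  refine integral_congr_ae ?_
  filter_upwards [ae_restrict_of_ae h] with y hy
  rw [hy]

/-- The isometry `L²(∂(e D)) → L²(∂D)`, `φ ↦ φ ∘ e`. -/
noncomputable def boundaryPullback (D : Set E3) (e : E3 ≃ₗᵢ[ℝ] E3) :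
    L2Boundary (e '' D) ≃L[ℂ] L2Boundary D :=
  ContinuousLinearEquiv.equivOfInverse
    (Lp.compMeasurePreservingₗᵢ ℂ e (measurePreserving_surfaceMeasure D e)).toContinuousLinearMap
    (Lp.compMeasurePreservingₗᵢ ℂ e.symm
      (measurePreserving_surfaceMeasure_symm D e)).toContinuousLinearMap
    (fun φ => by
      refine Lp.ext ?_
      refine (Lp.coeFn_compMeasurePreserving _ (measurePreserving_surfaceMeasure_symm D e)).trans ?_
      filter_upwards [(measurePreserving_surfaceMeasure_symm D e).quasiMeasurePreserving.ae
        (Lp.coeFn_compMeasurePreserving φ (measurePreserving_surfaceMeasure D e))] with x hx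
      refine hx.trans ?_
      simp)
    (fun φ => by
      refine Lp.ext ?_
      refine (Lp.coeFn_compMeasurePreserving _ (measurePreserving_surfaceMeasure D e)).trans ?_
      filter_upwards [(measurePreserving_surfaceMeasure D e).quasiMeasurePreserving.ae
        (Lp.coeFn_compMeasurePreserving φ (measurePreserving_surfaceMeasure_symm D e))] with x hx
      refine hx.trans ?_
      simp)

theorem coeFn_boundaryPullback (D : Set E3) (e : E3 ≃ₗᵢ[ℝ] E3) (φ : L2Boundary (e '' D)) :
    boundaryPullback D e φ =ᵐ[surfaceMeasure D] φ ∘ e :=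
  Lp.coeFn_compMeasurePreserving φ (measurePreserving_surfaceMeasure D e)

theorem IsNPAdjoint.unique {D : Set E3} {S T : L2Boundary D →L[ℂ] L2Boundary D}
    (hS : IsNPAdjoint D S) (hT : IsNPAdjoint D T) : S = T := by
  ext1 φ
  refine Lp.ext ?_
  filter_upwards [hS φ, hT φ] with x h1 h2
  exact tendsto_nhds_unique h1 h2

theorem IsNPAdjoint.npAdjoint_eq {D : Set E3} {T : L2Boundary D →L[ℂ] L2Boundary D}
    (hT : IsNPAdjoint D T) : npAdjoint D = T := by
  have hex : ∃ T, IsNPAdjoint D T := ⟨T, hT⟩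
  rw [npAdjoint, dif_pos hex]
  exact hex.choose_spec.unique hT

/-- Conjugation of operators by the pullback of boundary functions. -/
noncomputable def boundaryConj (D : Set E3) (e : E3 ≃ₗᵢ[ℝ] E3) :
    (L2Boundary (e '' D) →L[ℂ] L2Boundary (e '' D)) ≃A[ℂ] (L2Boundary D →L[ℂ] L2Boundary D) :=
  (boundaryPullback D e).conjContinuousAlgEquiv

theorem boundaryConj_apply (D : Set E3) (e : E3 ≃ₗᵢ[ℝ] E3)
    (T : L2Boundary (e '' D) →L[ℂ] L2Boundary (e '' D)) (φ : L2Boundary D) :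
    boundaryConj D e T φ = boundaryPullback D e (T ((boundaryPullback D e).symm φ)) := rfl

/-- The truncated integrals agree pointwise and do not see the choice of representative of φ, while
`e` matches null sets. The principal value statements therefore correspond. -/
theorem isNPAdjoint_boundaryConj_iff (D : Set E3) (e : E3 ≃ₗᵢ[ℝ] E3)
    (T : L2Boundary (e '' D) →L[ℂ] L2Boundary (e '' D)) :
    IsNPAdjoint D (boundaryConj D e T) ↔ IsNPAdjoint (e '' D) T := by
  have hae (p : E3 → Prop) :
      (∀ᵐ x ∂surfaceMeasure D, p (e x)) ↔ ∀ᵐ x ∂surfaceMeasure (e '' D), p x := by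
    rw [← (measurePreserving_surfaceMeasure D e).map_eq]
    exact e.toHomeomorph.measurableEmbedding.ae_map_iff.symm
  have key (φ : L2Boundary (e '' D)) :
      (∀ᵐ x ∂surfaceMeasure D, Tendsto
        (fun ε : ℝ => truncatedNPAdjoint D ε (boundaryPullback D e φ) x) (𝓝[>] 0)
          (𝓝 (boundaryPullback D e (T φ) x))) ↔
      ∀ᵐ x ∂surfaceMeasure (e '' D), Tendsto
        (fun ε : ℝ => truncatedNPAdjoint (e '' D) ε φ x) (𝓝[>] 0) (𝓝 (T φ x)) := by
    rw [← hae]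
    refine eventually_congr ?_
    filter_upwards [coeFn_boundaryPullback D e (T φ)] with x hx
    rw [hx]
    simp only [truncatedNPAdjoint_congr_ae D _ (coeFn_boundaryPullback D e φ),
      ← truncatedNPAdjoint_image]
    rfl
  constructor
  · intro h φ
    refine (key φ).1 ?_
    simpa [boundaryConj_apply] using h (boundaryPullback D e φ)
  · intro h φ
    obtain ⟨ψ, rfl⟩ := (boundaryPullback D e).surjective φ
    simpa [boundaryConj_apply] using (key ψ).2 (h ψ)

/-- Existence of the operator transfers in both directions, so when there is none the default value
0 is taken on both sides at once. -/
theorem boundaryConj_npAdjoint (D : Set E3) (e : E3 ≃ₗᵢ[ℝ] E3) :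
    boundaryConj D e (npAdjoint (e '' D)) = npAdjoint D := by
  by_cases h : ∃ T, IsNPAdjoint (e '' D) T
  · obtain ⟨T, hT⟩ := h
    rw [hT.npAdjoint_eq, ((isNPAdjoint_boundaryConj_iff D e T).2 hT).npAdjoint_eq]
  · have h' : ¬ ∃ T, IsNPAdjoint D T := by
      rintro ⟨S, hS⟩
      obtain ⟨T, rfl⟩ := (boundaryConj D e).surjective S
      exact h ⟨T, (isNPAdjoint_boundaryConj_iff D e T).1 hS⟩
    rw [npAdjoint, dif_neg h, npAdjoint, dif_neg h', map_zero]

theorem boundaryConj_npResolvent (lam : ℝ) (D : Set E3) (e : E3 ≃ₗᵢ[ℝ] E3) :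
    boundaryConj D e (npResolvent lam (e '' D)) = npResolvent lam D := by
  have hinv (T : L2Boundary (e '' D) →L[ℂ] L2Boundary (e '' D)) :
      boundaryConj D e (Ring.inverse T) = Ring.inverse (boundaryConj D e T) := by
    by_cases hT : IsUnit T
    · obtain ⟨u, rfl⟩ := hT
      rw [Ring.inverse_unit]
      exact (Ring.inverse_unit (Units.map (MonoidHomClass.toMonoidHom (boundaryConj D e)) u)).symm
    · rw [Ring.inverse_non_unit _ hT, Ring.inverse_non_unit, map_zero]
      exact fun h => hT ((MulEquiv.isUnit_map (boundaryConj D e)).1 h)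
  rw [npResolvent, hinv, map_sub, map_smul, map_one, boundaryConj_npAdjoint, npResolvent]

theorem boundaryPullback_npResolvent (lam : ℝ) (D : Set E3) (e : E3 ≃ₗᵢ[ℝ] E3)
    (φ : L2Boundary (e '' D)) :
    boundaryPullback D e (npResolvent lam (e '' D) φ) =
      npResolvent lam D (boundaryPullback D e φ) := by
  rw [← boundaryConj_npResolvent lam D e, boundaryConj_apply,
    ContinuousLinearEquiv.symm_apply_apply]

/-! ### Binary forms and the Wigner matrix -/

/-- The normalised monomial `u ^ (n - m) v ^ (n + m) / √((n - m)! (n + m)!)`. -/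
noncomputable def spinMonomial (n : ℕ) (m : ℤ) (u v : ℂ) : ℂ :=
  u ^ (n - m).toNat * v ^ (n + m).toNat /
    (Real.sqrt ((n - m).toNat.factorial * (n + m).toNat.factorial) : ℂ)

/-- Normalised monomials of the same degree are linearly independent. -/
theorem eq_of_sum_mul_spinMonomial_eq {n : ℕ} {a b : ℤ → ℂ}
    (h : ∀ u v : ℂ, ∑ m ∈ Finset.Icc (-(n : ℤ)) n, a m * spinMonomial n m u v =
      ∑ m ∈ Finset.Icc (-(n : ℤ)) n, b m * spinMonomial n m u v)
    {m : ℤ} (hm : m ∈ Finset.Icc (-(n : ℤ)) n) : a m = b m := by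
  let w (m : ℤ) : ℂ := (Real.sqrt ((n - m).toNat.factorial * (n + m).toNat.factorial) : ℂ)
  have hw (m : ℤ) : w m ≠ 0 := by
    simp only [w, ne_eq, Complex.ofReal_eq_zero]
    positivity
  -- At u = 1 the sum is a polynomial in v, and distinct orders have distinct exponents n + k.
  let P (c : ℤ → ℂ) : Polynomial ℂ :=
    ∑ k ∈ Finset.Icc (-(n : ℤ)) n, Polynomial.monomial (n + k).toNat (c k / w k)
  have hP (c : ℤ → ℂ) (v : ℂ) :
      (P c).eval v = ∑ k ∈ Finset.Icc (-(n : ℤ)) n, c k * spinMonomial n k 1 v := by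
    simp only [P, Polynomial.eval_finsetSum, Polynomial.eval_monomial, spinMonomial, one_pow,
      one_mul]
    exact Finset.sum_congr rfl fun k _ => by ring
  have hc (c : ℤ → ℂ) : (P c).coeff (n + m).toNat = c m / w m := by
    simp only [P, Polynomial.finsetSum_coeff, Polynomial.coeff_monomial]
    rw [Finset.sum_eq_single_of_mem m hm, if_pos rfl]
    intro k hk hkm
    rw [Finset.mem_Icc] at hk hm
    exact if_neg (by omega)
  have hab : P a = P b := Polynomial.funext fun v => by rw [hP, hP, h]
  have := hc a
  rw [hab, hc b] at this
  exact ((div_left_inj' (hw m)).1 this).symm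

/-- Here a is the summation index s, and a, b, c, d are the four numbers whose factorials form the
denominator. In these variables the summand is a product of two binomial terms, one from (Cu +
Sv)^(n - m') and one from (Cv - Su)^(n + m'); the sign reduces to (-1)^d. -/
theorem wignerSmallD_term (a b c d n : ℕ) (m' m : ℤ) (hp : (n : ℤ) - m' = a + c)
    (hq : (n : ℤ) + m' = b + d) (hm : (n : ℤ) + m = a + b) (C S : ℝ) (u v : ℂ) :
    ((Real.sqrt (((n + m').toNat.factorial : ℝ) * ((n - m').toNat.factorial : ℝ) *
      ((n + m).toNat.factorial : ℝ) * ((n - m).toNat.factorial : ℝ)) *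
      ((-1 : ℝ) ^ (m' + m + (a : ℤ)) * C ^ (2 * (n - (a : ℤ)) + m - m').toNat *
          S ^ (2 * (a : ℤ) - m + m').toNat /
        (((n + m - (a : ℤ)).toNat.factorial : ℝ) * ((a : ℤ).toNat.factorial : ℝ) *
          ((m' - m + (a : ℤ)).toNat.factorial : ℝ) *
          ((n - m' - (a : ℤ)).toNat.factorial : ℝ))) : ℝ) : ℂ) * spinMonomial n m u v =
    ((S * v) ^ a * (C * u) ^ c * ((a + c).choose a)) *
      ((C * v) ^ b * (-(S * u)) ^ d * ((b + d).choose b)) /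
      (Real.sqrt ((n - m').toNat.factorial * (n + m').toNat.factorial) : ℂ) := by
  have hsum : (a + b + c + d : ℤ) = 2 * n := by linarith
  have hm2 : (n : ℤ) - m = c + d := by linarith
  rw [spinMonomial, hp, hq, hm, hm2, show (a + b - (a : ℤ) : ℤ) = b by ring,
    show 2 * (n - (a : ℤ)) + m - m' = b + c by linarith,
    show 2 * (a : ℤ) - m + m' = a + d by linarith, show m' - m + a = d by linarith,
    show (a + c - (a : ℤ) : ℤ) = c by ring,
    show m' + m + (a : ℤ) = d + 2 * (a + b - n) by linarith, zpow_add₀ (by norm_num), zpow_mul]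
  simp only [← Nat.cast_add, Int.toNat_natCast, zpow_natCast]
  rw [show ((-1 : ℝ) ^ (2 : ℤ)) = 1 by norm_num, one_zpow, mul_one, mul_assoc,
    mul_comm ((b + d).factorial : ℝ), mul_assoc, ← mul_assoc ((a + c).factorial : ℝ),
    Real.sqrt_mul (by positivity), mul_comm ((a + b).factorial : ℝ)]
  have hA : (Real.sqrt ((a + c).factorial * (b + d).factorial) : ℂ) ≠ 0 := by
    rw [Complex.ofReal_ne_zero]
    positivity
  have hA2 : (Real.sqrt ((a + c).factorial * (b + d).factorial) : ℂ) ^ 2 =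
      (a + c).factorial * (b + d).factorial := by
    rw [← Complex.ofReal_pow, Real.sq_sqrt (by positivity)]
    push_cast
    ring
  have hB : (Real.sqrt ((c + d).factorial * (a + b).factorial) : ℂ) ≠ 0 := by
    rw [Complex.ofReal_ne_zero]
    positivity
  have h1 : ((a + c).factorial : ℂ) = (a + c).choose a * a.factorial * c.factorial := by
    rw [Nat.choose_symm_add]
    exact_mod_cast (Nat.add_choose_mul_factorial_mul_factorial a c).symm
  have h2 : ((b + d).factorial : ℂ) = (b + d).choose b * b.factorial * d.factorial := by
    rw [Nat.choose_symm_add]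
    exact_mod_cast (Nat.add_choose_mul_factorial_mul_factorial b d).symm
  have ha : (a.factorial : ℂ) ≠ 0 := by exact_mod_cast a.factorial_ne_zero
  have hb : (b.factorial : ℂ) ≠ 0 := by exact_mod_cast b.factorial_ne_zero
  have hc : (c.factorial : ℂ) ≠ 0 := by exact_mod_cast c.factorial_ne_zero
  have hd : (d.factorial : ℂ) ≠ 0 := by exact_mod_cast d.factorial_ne_zero
  rw [h1, h2] at hA2
  push_cast at *
  generalize (Real.sqrt ((a + c).factorial * (b + d).factorial) : ℂ) = A at *
  generalize (Real.sqrt ((c + d).factorial * (a + b).factorial) : ℂ) = B at *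
  rw [neg_pow (S * u : ℂ)]
  field_simp
  rw [hA2]
  ring

theorem spinMonomial_rotate {n : ℕ} {m' : ℤ} (hm' : m' ∈ Finset.Icc (-(n : ℤ)) n) (β : ℝ)
    (u v : ℂ) :
    spinMonomial n m' (Real.cos (β / 2) * u + Real.sin (β / 2) * v)
        (Real.cos (β / 2) * v - Real.sin (β / 2) * u) =
      ∑ m ∈ Finset.Icc (-(n : ℤ)) n, (wignerSmallD n m' m β : ℂ) * spinMonomial n m u v := by
  rw [Finset.mem_Icc] at hm'
  have hL : spinMonomial n m' (Real.cos (β / 2) * u + Real.sin (β / 2) * v)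
        (Real.cos (β / 2) * v - Real.sin (β / 2) * u) =
      ∑ a ∈ Finset.range ((n - m').toNat + 1), ∑ b ∈ Finset.range ((n + m').toNat + 1),
      ((Real.sin (β / 2) * v) ^ a * (Real.cos (β / 2) * u) ^ ((n - m').toNat - a) *
        ((n - m').toNat.choose a)) *
      ((Real.cos (β / 2) * v) ^ b * (-(Real.sin (β / 2) * u)) ^ ((n + m').toNat - b) *
        ((n + m').toNat.choose b)) /
      (Real.sqrt ((n - m').toNat.factorial * (n + m').toNat.factorial) : ℂ) := by
    rw [spinMonomial, add_comm, sub_eq_add_neg (_ * v), add_pow, add_pow, Finset.sum_mul_sum,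
      Finset.sum_div]
    exact Finset.sum_congr rfl fun a _ => Finset.sum_div _ _ _
  rw [hL]
  simp only [wignerSmallD, Finset.mul_sum, Complex.ofReal_sum, Finset.sum_mul]
  rw [Finset.sum_sigma', Finset.sum_sigma']
  -- The term indexed by (a, b) contributes v^(a + b), so it belongs to the order m = a + b - n,
  -- with s = a.
  refine Finset.sum_bij' (fun p _ => ⟨(p.1 : ℤ) + p.2 - n, (p.1 : ℤ)⟩)
    (fun p _ => ⟨p.2.toNat, (n + p.1 - p.2).toNat⟩) ?_ ?_ ?_ ?_ ?_
  · rintro ⟨a, b⟩ h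
    simp only [Finset.mem_sigma, Finset.mem_range, Finset.mem_Icc] at h ⊢
    omega
  · rintro ⟨m, s⟩ h
    simp only [Finset.mem_sigma, Finset.mem_range, Finset.mem_Icc] at h ⊢
    omega
  · rintro ⟨a, b⟩ h
    simp only [Sigma.mk.injEq, heq_eq_eq]
    omega
  · rintro ⟨m, s⟩ h
    simp only [Finset.mem_sigma, Finset.mem_Icc] at h
    simp only [Sigma.mk.injEq, heq_eq_eq]
    omega
  · rintro ⟨a, b⟩ h
    simp only [Finset.mem_sigma, Finset.mem_range] at h
    obtain ⟨c, hc⟩ := Nat.exists_eq_add_of_le (Nat.lt_succ_iff.1 h.1)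
    obtain ⟨d, hd⟩ := Nat.exists_eq_add_of_le (Nat.lt_succ_iff.1 h.2)
    dsimp only
    rw [wignerSmallD_term a b c d n m' _ (by omega) (by omega) (by omega), hc, hd,
      Nat.add_sub_cancel_left, Nat.add_sub_cancel_left]

/-- `d_n^{m,m'}(-β) = d_n^{m',m}(β)`. -/
theorem wignerSmallD_neg (n : ℕ) (m' m : ℤ) (β : ℝ) :
    wignerSmallD n m m' (-β) = wignerSmallD n m' m β := by
  rw [wignerSmallD, wignerSmallD]
  congr 1
  · congr 1
    ring
  refine Finset.sum_bij' (fun s _ => s + m - m') (fun s _ => s + m' - m) ?_ ?_ ?_ ?_ ?_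
  · intro s h
    simp only [Finset.mem_Icc] at h ⊢
    omega
  · intro s h
    simp only [Finset.mem_Icc] at h ⊢
    omega
  · intro s _
    ring
  · intro s _
    ring
  · intro s h
    simp only [Finset.mem_Icc, max_le_iff, le_min_iff] at h
    rw [neg_div, Real.cos_neg, Real.sin_neg, neg_pow (Real.sin (β / 2)),
      show 2 * (n - (s + m - m')) + m - m' = 2 * (n - s) + m' - m by ring,
      show 2 * (s + m - m') - m + m' = 2 * s - m' + m by ring,
      show n + m - (s + m - m') = n + m' - s by ring,
      show m' - m + (s + m - m') = s by ring,
      show n - m' - (s + m - m') = n - m - s by ring,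
      show s + m - m' = m - m' + s by ring]
    -- The shift of s changes the sign exponent by m - m', which is the parity of the power of the
    -- sine.
    have hsgn : (-1 : ℝ) ^ (m + m' + s) * (-1) ^ (2 * s - m' + m).toNat =
        (-1) ^ (m' + m + (m - m' + s)) := by
      rw [← zpow_natCast, Int.toNat_of_nonneg (by omega), ← zpow_add₀ (by norm_num),
        show m + m' + s + (2 * s - m' + m) = m' + m + (m - m' + s) + 2 * s by ring,
        zpow_add₀ (by norm_num), zpow_mul]
      norm_num
    rw [← hsgn]
    ring

/-- Rotating (u, v) by β and then by -β is the identity. Expanding both rotations, with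
`wignerSmallD_neg` turning the second into a transpose, and comparing coefficients gives
orthogonality. -/
theorem sum_wignerSmallD_mul_wignerSmallD {n : ℕ} {i k : ℤ} (hi : i ∈ Finset.Icc (-(n : ℤ)) n)
    (hk : k ∈ Finset.Icc (-(n : ℤ)) n) (β : ℝ) :
    ∑ m ∈ Finset.Icc (-(n : ℤ)) n, wignerSmallD n m i β * wignerSmallD n m k β =
      if i = k then 1 else 0 := by
  have key (u v : ℂ) : ∑ k ∈ Finset.Icc (-(n : ℤ)) n, (if i = k then (1 : ℂ) else 0) *
      spinMonomial n k u v = ∑ k ∈ Finset.Icc (-(n : ℤ)) n,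
      ((∑ m ∈ Finset.Icc (-(n : ℤ)) n, wignerSmallD n m i β * wignerSmallD n m k β : ℝ) : ℂ) *
        spinMonomial n k u v := by
    have hcs : (Real.cos (β / 2) : ℂ) ^ 2 + (Real.sin (β / 2) : ℂ) ^ 2 = 1 := by
      exact_mod_cast Real.cos_sq_add_sin_sq (β / 2)
    have h := spinMonomial_rotate hi (-β) (Real.cos (β / 2) * u + Real.sin (β / 2) * v)
      (Real.cos (β / 2) * v - Real.sin (β / 2) * u)
    rw [neg_div, Real.cos_neg, Real.sin_neg] at h
    generalize hC : (Real.cos (β / 2) : ℂ) = C at *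
    rw [Complex.ofReal_neg] at h
    generalize hS : (Real.sin (β / 2) : ℂ) = S at *
    rw [show C * (C * u + S * v) + -S * (C * v - S * u) = u by linear_combination u * hcs,
      show C * (C * v - S * u) - -S * (C * u + S * v) = v by linear_combination v * hcs] at h
    simp only [ite_mul, one_mul, zero_mul, Finset.sum_ite_eq, if_pos hi]
    rw [h]
    simp only [Complex.ofReal_sum, Complex.ofReal_mul, Finset.sum_mul]
    rw [Finset.sum_comm]
    refine Finset.sum_congr rfl fun m hm => ?_
    have hrot := spinMonomial_rotate hm β u v
    rw [hC, hS] at hrot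
    rw [hrot, wignerSmallD_neg, Finset.mul_sum]
    exact Finset.sum_congr rfl fun k _ => by ring
  have := eq_of_sum_mul_spinMonomial_eq key hk
  have h2 : ((if i = k then (1 : ℝ) else 0 : ℝ) : ℂ) = if i = k then (1 : ℂ) else 0 := by
    split_ifs <;> simp
  rw [← h2] at this
  exact (Complex.ofReal_injective this).symm

theorem wignerQ_mem_unitaryGroup (n : ℕ) (α β γ : ℝ) :
    wignerQ n α β γ ∈ Matrix.unitaryGroup (Orders n) ℂ := by
  have hconj (z : ℝ) (m : ℤ) :
      conj (Complex.exp (Complex.I * m * z)) = (Complex.exp (Complex.I * m * z))⁻¹ := by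
    rw [← Complex.exp_conj, ← Complex.exp_neg]
    simp
  rw [Matrix.mem_unitaryGroup_iff]
  ext m k
  -- The γ phase cancels against its conjugate inside the sum; the α phase leaves it and is trivial
  -- on the diagonal.
  have hterm (m' : Orders n) : wignerQ n α β γ m m' * (star (wignerQ n α β γ)) m' k =
      Complex.exp (Complex.I * m * α) * (Complex.exp (Complex.I * k * α))⁻¹ *
        ((wignerSmallD n m' m β * wignerSmallD n m' k β : ℝ) : ℂ) := by
    rw [Matrix.star_apply]
    simp only [wignerQ, wignerRho, Matrix.of_apply, RCLike.star_def, map_mul, hconj,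
      Complex.conj_ofReal, Complex.ofReal_mul]
    have := Complex.exp_ne_zero (Complex.I * (m' : ℤ) * γ)
    field_simp
  rw [Matrix.mul_apply, Finset.sum_congr rfl fun m' _ => hterm m', ← Finset.mul_sum,
    ← Complex.ofReal_sum, Finset.sum_coe_sort (Finset.Icc (-(n : ℤ)) n)
      (fun m' => wignerSmallD n m' m β * wignerSmallD n m' k β),
    sum_wignerSmallD_mul_wignerSmallD m.2 k.2, Matrix.one_apply]
  by_cases h : m = k
  · subst h
    simp
  · rw [if_neg h, if_neg (fun h' => h (Subtype.ext h'))]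
    simp

/-! ### Powers of quadratic polynomials -/

section Quadratic

open Polynomial

theorem natDegree_quadratic_pow_le {K : Type*} [CommRing K] (a b c : K) (n : ℕ) :
    ((C a + C b * X + C c * X ^ 2) ^ n).natDegree ≤ 2 * n := by
  rw [mul_comm 2 n]
  have h : (C a + C b * X + C c * X ^ 2).natDegree ≤ 2 := by compute_degree
  exact natDegree_pow_le_of_le n h

theorem reflect_quadratic_pow {K : Type*} [CommRing K] (a b c : K) (n : ℕ) :
    reflect (2 * n) ((C a + C b * X + C c * X ^ 2) ^ n) = (C c + C b * X + C a * X ^ 2) ^ n := by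
  have h2 : reflect 2 (C a + C b * X + C c * X ^ 2) = C c + C b * X + C a * X ^ 2 := by
    have h1 := reflect_C_mul_X_pow 2 1 (c := b)
    rw [pow_one] at h1
    rw [reflect_add, reflect_add, reflect_C, h1, reflect_C_mul_X_pow, revAt_le (by norm_num),
      revAt_le le_rfl]
    norm_num
    ring
  induction n with
  | zero => simp
  | succ n ih =>
    rw [pow_succ (C a + _ + _), pow_succ (C c + _ + _), mul_add, mul_one,
      reflect_mul _ _ (natDegree_quadratic_pow_le a b c n) (by compute_degree), ih, h2]

/-- The coefficients of a power of a quadratic polynomial are symmetric in the outer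
coefficients. -/
theorem coeff_quadratic_pow_sub {K : Type*} [CommRing K] (a b c : K) {n k : ℕ} (hk : k ≤ n) :
    ((C a + C b * X + C c * X ^ 2) ^ n).coeff (n - k) =
      ((C c + C b * X + C a * X ^ 2) ^ n).coeff (n + k) := by
  rw [← reflect_quadratic_pow a b c n, coeff_reflect, revAt_le (by omega)]
  congr 1
  omega

/-- Substituting cX for X in ac + bX + X² gives c(a + bX + cX²). Hence, apart from the factor c^k,
only b and the product ac matter, which later separates the azimuthal phase from the real Legendre
part. For c = 0 the two sides are compared directly. -/
theorem coeff_quadratic_pow_add {K : Type*} [Field K] (a b c : K) (n k : ℕ) :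
    ((C a + C b * X + C c * X ^ 2) ^ n).coeff (n + k) =
      c ^ k * ((C (a * c) + C b * X + X ^ 2) ^ n).coeff (n + k) := by
  by_cases hc : c = 0
  · subst hc
    rcases Nat.eq_zero_or_pos k with rfl | hk
    · have h1 : (C b * X + X ^ 2 : K[X]) ^ n = (C b + X) ^ n * X ^ n := by
        rw [← mul_pow]
        ring
      have h2 := coeff_pow_of_natDegree_le (p := (C a + C b * X : K[X])) (n := 1) (m := n)
        (by compute_degree)
      rw [mul_one] at h2
      simp only [map_zero, zero_mul, add_zero, mul_zero, zero_add, pow_zero, one_mul]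
      rw [h1, coeff_mul_X_pow', if_pos le_rfl, Nat.sub_self, coeff_zero_eq_eval_zero, h2]
      simp
    · rw [zero_pow hk.ne', zero_mul]
      refine coeff_eq_zero_of_natDegree_lt (lt_of_le_of_lt ?_ (Nat.lt_add_of_pos_right hk))
      refine (natDegree_pow_le_of_le n (m := 1) ?_).trans (by simp)
      simp only [map_zero, zero_mul, add_zero]
      compute_degree
  · have h : ((C (a * c) + C b * X + X ^ 2) ^ n).comp (C c * X) =
        C (c ^ n) * (C a + C b * X + C c * X ^ 2) ^ n := by
      simp only [pow_comp, add_comp, mul_comp, C_comp, X_comp, C_pow, ← mul_pow, C_mul]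
      ring
    have h' := congrArg (coeff · (n + k)) h
    simp only [comp_C_mul_X_coeff, coeff_C_mul, pow_add] at h'
    refine mul_left_cancel₀ (pow_ne_zero n hc) ?_
    linear_combination -h'

theorem sum_coeff_quadratic_pow {K : Type*} [Field K] (a b c u v : K) (n : ℕ) :
    ∑ j ∈ Finset.range (2 * n + 1), ((C a + C b * X + C c * X ^ 2) ^ n).coeff j *
      (u ^ (2 * n - j) * v ^ j) = (a * u ^ 2 + b * (u * v) + c * v ^ 2) ^ n := by
  by_cases hu : u = 0
  · subst hu
    rw [Finset.sum_range_succ, Finset.sum_eq_zero, mul_comm 2 n, coeff_pow_of_natDegree_le]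
    · simp [mul_pow, pow_mul, mul_comm n 2]
    · compute_degree
    · intro j hj
      rw [Finset.mem_range] at hj
      rw [zero_pow (by omega), zero_mul, mul_zero]
  · have h := eval_eq_sum_range' (Nat.lt_succ_of_le (natDegree_quadratic_pow_le a b c n)) (v / u)
    have h2 : (a * u ^ 2 + b * (u * v) + c * v ^ 2) ^ n = u ^ (2 * n) *
        ((C a + C b * X + C c * X ^ 2) ^ n).eval (v / u) := by
      rw [pow_mul]
      simp only [eval_pow, eval_add, eval_mul, eval_C, eval_X, ← mul_pow]
      congr 1
      field_simp
    rw [h2, h, Finset.mul_sum]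
    refine Finset.sum_congr rfl fun j hj => ?_
    rw [Finset.mem_range] at hj
    rw [div_pow, ← pow_sub_mul_pow u (show j ≤ 2 * n by omega)]
    field_simp

theorem eval_iterate_derivative_eq_taylor {K : Type*} [CommRing K] (p : K[X]) (j : ℕ) (t : K) :
    (derivative^[j] p).eval t = j.factorial * (taylor t p).coeff j := by
  rw [taylor_coeff, ← factorial_smul_hasseDeriv, LinearMap.smul_apply, eval_smul, nsmul_eq_mul]

/-- The associated Legendre functions are coefficients of powers of quadratic polynomials. -/
theorem coeff_legendre_pow {t : ℝ} (ht : t ^ 2 ≤ 1) {e : ℂ} (he : e ≠ 0) (n k : ℕ) :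
    (2 ^ n * n.factorial : ℂ) * assocLegendreNat n k t * ((-e) ^ k) =
      (n + k).factorial * ((C (Real.sqrt (1 - t ^ 2) * e⁻¹) + C (2 * t : ℂ) * X +
        C (-(Real.sqrt (1 - t ^ 2) * e)) * X ^ 2) ^ n).coeff (n + k) := by
  have hs : (Real.sqrt (1 - t ^ 2) : ℂ) ^ 2 = 1 - t ^ 2 := by
    rw [← Complex.ofReal_pow, Real.sq_sqrt (by linarith)]
    push_cast
    ring
  -- Since (X + t)² - 1 = -(1 - t²) + 2tX + X², the derivatives in Rodrigues' formula become
  -- coefficients of a power of a quadratic.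
  have hT : (taylor t ((X ^ 2 - 1 : ℝ[X]) ^ n)) =
      (C (-(1 - t ^ 2)) + C (2 * t) * X + X ^ 2) ^ n := by
    rw [taylor_pow, map_sub, taylor_one, taylor_pow, taylor_X]
    congr 1
    simp only [map_neg, map_sub, map_one, map_pow, map_mul, map_ofNat]
    ring
  have hmap : ((C (Real.sqrt (1 - t ^ 2) * e⁻¹ * -(Real.sqrt (1 - t ^ 2) * e)) +
      C (2 * t : ℂ) * X + X ^ 2) ^ n) =
      ((C (-(1 - t ^ 2)) + C (2 * t) * X + X ^ 2) ^ n : ℝ[X]).map (algebraMap ℝ ℂ) := by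
    simp only [Polynomial.map_pow, Polynomial.map_add, Polynomial.map_mul, map_C, map_X]
    congr 4
    · simp only [Complex.coe_algebraMap]
      push_cast
      field_simp
      linear_combination -hs
    · simp
  rw [coeff_quadratic_pow_add, hmap, coeff_map, assocLegendreNat,
    eval_iterate_derivative_eq_taylor, hT, Complex.coe_algebraMap]
  have h2 : (n.factorial : ℂ) ≠ 0 := by exact_mod_cast n.factorial_ne_zero
  generalize ((C (-(1 - t ^ 2)) + C (2 * t) * X + X ^ 2) ^ n : ℝ[X]).coeff (n + k) = w
  push_cast
  rw [neg_pow e, neg_pow (_ * e), mul_pow]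
  field_simp

end Quadratic

/-! ### Solid harmonics -/

/-- The quadratic form in `(u, v)` attached to a point `x`; its powers generate the solid
harmonics. -/
noncomputable def solidForm (x : E3) (u v : ℂ) : ℂ :=
  conj (⟨x 0, x 1⟩ : ℂ) * u ^ 2 + (2 * x 2 : ℂ) * (u * v) + -(⟨x 0, x 1⟩ : ℂ) * v ^ 2

open Polynomial in
/-- The dehomogenisation of `solidForm`. -/
noncomputable def solidPoly (x : E3) : ℂ[X] :=
  C (conj (⟨x 0, x 1⟩ : ℂ)) + C (2 * x 2 : ℂ) * X + C (-(⟨x 0, x 1⟩ : ℂ)) * X ^ 2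

/-- The normalisation `√((2n + 1) / 4π) / (2ⁿ n!)`. -/
noncomputable def solidNormalization (n : ℕ) : ℂ :=
  (Real.sqrt ((2 * n + 1) / (4 * Real.pi)) : ℂ) / (2 ^ n * n.factorial)

theorem abs_div_norm_le_one (x : E3) (i : Fin 3) : |x i / ‖x‖| ≤ 1 := by
  rw [abs_div, abs_norm]
  exact div_le_one_of_le₀ (by simpa using PiLp.norm_apply_le x i) (norm_nonneg _)

theorem cos_polarAngle (x : E3) : Real.cos (polarAngle x) = x 2 / ‖x‖ :=
  Real.cos_arccos (abs_le.1 (abs_div_norm_le_one x 2)).1 (abs_le.1 (abs_div_norm_le_one x 2)).2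

theorem norm_mul_cos_polarAngle (x : E3) : ‖x‖ * Real.cos (polarAngle x) = x 2 := by
  rw [cos_polarAngle]
  by_cases h : x = 0
  · simp [h]
  · exact mul_div_cancel₀ _ (norm_ne_zero_iff.2 h)

theorem norm_mul_sin_mul_exp_azimuth (x : E3) :
    (‖x‖ : ℂ) * (Real.sqrt (1 - Real.cos (polarAngle x) ^ 2) * Complex.exp (azimuth x * Complex.I))
      = ⟨x 0, x 1⟩ := by
  have h : ‖x‖ * Real.sqrt (1 - Real.cos (polarAngle x) ^ 2) = ‖(⟨x 0, x 1⟩ : ℂ)‖ := by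
    have hz := norm_mul_cos_polarAngle x
    have hn : ‖x‖ ^ 2 = x 0 ^ 2 + x 1 ^ 2 + x 2 ^ 2 := by
      rw [EuclideanSpace.real_norm_sq_eq, Fin.sum_univ_three]
    rw [Complex.norm_eq_sqrt_sq_add_sq, ← Real.sqrt_sq (norm_nonneg x),
      ← Real.sqrt_mul (by positivity)]
    congr 1
    rw [← hz] at hn
    linear_combination hn
  rw [← mul_assoc, ← Complex.ofReal_mul, h]
  exact Complex.norm_mul_exp_arg_mul_I _

open Polynomial in
-- A factor ‖x‖ comes out of each coefficient of `solidPoly`. The identities behind this also hold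
-- at the origin and on the third axis, where the angles take default values.
theorem coeff_solidPoly_pow (x : E3) (n j : ℕ) :
    (solidPoly x ^ n).coeff j = (‖x‖ : ℂ) ^ n *
      ((C (Real.sqrt (1 - Real.cos (polarAngle x) ^ 2) *
          (Complex.exp (azimuth x * Complex.I))⁻¹) +
        C (2 * (Real.cos (polarAngle x) : ℝ) : ℂ) * X +
        C (-(Real.sqrt (1 - Real.cos (polarAngle x) ^ 2) *
          Complex.exp (azimuth x * Complex.I))) * X ^ 2) ^ n).coeff j := by
  have hconj : (‖x‖ : ℂ) * (Real.sqrt (1 - Real.cos (polarAngle x) ^ 2) *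
      (Complex.exp (azimuth x * Complex.I))⁻¹) = conj (⟨x 0, x 1⟩ : ℂ) := by
    rw [← norm_mul_sin_mul_exp_azimuth x]
    simp only [map_mul, Complex.conj_ofReal, ← Complex.exp_conj, Complex.conj_I, mul_neg,
      Complex.exp_neg]
  have hz : (‖x‖ : ℂ) * Real.cos (polarAngle x) = x 2 := by
    exact_mod_cast norm_mul_cos_polarAngle x
  rw [← coeff_C_mul, C_pow, ← mul_pow, solidPoly, ← hconj, ← norm_mul_sin_mul_exp_azimuth x, ← hz]
  congr 2
  simp only [C_mul, C_neg]
  ring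

/-- Since √(p!/q!) · q! = √(p! q!), the harmonic acquires a weight symmetric in p and q, the one
that `spinMonomial` divides by. -/
theorem sqrt_mul_div_factorial (n : ℕ) (p q : ℕ) (c w : ℂ)
    (h : (2 ^ n * n.factorial : ℂ) * w = q.factorial * c) :
    (Real.sqrt ((2 * n + 1) / (4 * Real.pi) * ((p.factorial : ℝ) / q.factorial)) : ℂ) * w =
      solidNormalization n * Real.sqrt (p.factorial * q.factorial) * c := by
  have hn : (2 ^ n * n.factorial : ℂ) ≠ 0 := by
    exact_mod_cast mul_ne_zero (by simp) n.factorial_ne_zero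
  have hq : (q.factorial : ℂ) ≠ 0 := by exact_mod_cast q.factorial_ne_zero
  have hw : w = q.factorial * c / (2 ^ n * n.factorial) := by
    rw [← h, mul_div_cancel_left₀ _ hn]
  have hs : Real.sqrt ((p.factorial : ℝ) / q.factorial) * q.factorial =
      Real.sqrt (p.factorial * q.factorial) := by
    have hq' : (q.factorial : ℝ) ≠ 0 := by positivity
    rw [← Real.sqrt_sq (Nat.cast_nonneg q.factorial), ← Real.sqrt_mul (by positivity),
      Real.sqrt_sq (Nat.cast_nonneg q.factorial)]
    congr 1
    field_simp
  rw [hw, solidNormalization, Real.sqrt_mul (by positivity), ← hs]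
  push_cast
  ring

theorem solidHarmonic_eq_coeff {n : ℕ} {m : ℤ} (hm : m ∈ Finset.Icc (-(n : ℤ)) n) (x : E3) :
    solidHarmonic n m x = solidNormalization n *
      Real.sqrt ((n - m).toNat.factorial * (n + m).toNat.factorial) *
        (solidPoly x ^ n).coeff (n + m).toNat := by
  rw [Finset.mem_Icc] at hm
  set t := Real.cos (polarAngle x) with ht
  set e := Complex.exp (azimuth x * Complex.I) with he
  have ht1 : t ^ 2 ≤ 1 := Real.cos_sq_le_one _
  have hexp (k : ℤ) : Complex.exp (Complex.I * k * azimuth x) = e ^ k := by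
    rw [he, ← Complex.exp_int_mul]
    congr 1
    ring
  have he0 : e ≠ 0 := Complex.exp_ne_zero _
  rw [coeff_solidPoly_pow, mul_left_comm, solidHarmonic, Complex.ofReal_pow]
  congr 1
  rw [sphericalHarmonic, hexp, ← ht, mul_comm ((-1 : ℂ) ^ m), mul_assoc, mul_assoc]
  refine sqrt_mul_div_factorial n _ _ _ _ ?_
  rcases le_or_gt 0 m with h | h
  · lift m to ℕ using h
    rw [← Nat.cast_add, Int.toNat_natCast, ← coeff_legendre_pow ht1 he0, assocLegendre,
      if_pos (Int.natCast_nonneg m), Int.toNat_natCast, zpow_natCast, zpow_natCast, neg_pow e]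
    ring
  · obtain ⟨k, rfl⟩ : ∃ k : ℕ, m = -k := ⟨m.natAbs, by omega⟩
    have hk : k ≤ n := by omega
    rw [show ((n : ℤ) + -k).toNat = n - k by omega, coeff_quadratic_pow_sub _ _ _ hk,
      assocLegendre, if_neg (by omega), Int.natAbs_neg, Int.natAbs_natCast]
    -- For negative order the coefficient is reflected about the middle, which swaps the outer
    -- coefficients of the quadratic. The swapped quadratic is the original one with e replaced by
    -- -e⁻¹.
    have hl := coeff_legendre_pow ht1 (neg_ne_zero.2 (inv_ne_zero he0)) n k
    rw [inv_neg, inv_inv, neg_neg, mul_neg, mul_neg, neg_neg] at hl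
    rw [← he]
    generalize (_ : Polynomial ℂ).coeff _ = w at hl ⊢
    have hs : ((-1 : ℂ) ^ k) ^ 2 = 1 := by
      rw [← pow_mul, mul_comm, pow_mul]
      norm_num
    have hs' : (-1 : ℂ) ^ (-(k : ℤ)) = (-1) ^ k := by
      rw [zpow_neg, zpow_natCast, inv_eq_of_mul_eq_one_right]
      rw [← sq, hs]
    have hf : ((n + k).factorial : ℂ) ≠ 0 := by exact_mod_cast (n + k).factorial_ne_zero
    rw [hs', zpow_neg, zpow_natCast, ← inv_pow]
    push_cast
    refine mul_left_cancel₀ hf ?_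
    rw [show ((n + k).factorial : ℂ) * ((n - k).factorial * w) =
      (n - k).factorial * ((n + k).factorial * w) by ring, ← hl]
    have hd : ((n + k).factorial : ℂ) * ((n - k).factorial / (n + k).factorial) =
      (n - k).factorial := by field_simp
    linear_combination (2 ^ n * n.factorial * assocLegendreNat n k t * e⁻¹ ^ k : ℂ) *
      (((-1 : ℂ) ^ k) ^ 2 * hd + (n - k).factorial * hs)

/-- The square roots in the harmonic and in the monomial cancel, leaving the homogeneous expansion
of the n-th power. -/
theorem sum_solidHarmonic_mul_spinMonomial (n : ℕ) (x : E3) (u v : ℂ) :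
    ∑ m ∈ Finset.Icc (-(n : ℤ)) n, solidHarmonic n m x * spinMonomial n m u v =
      solidNormalization n * solidForm x u v ^ n := by
  rw [solidForm, ← sum_coeff_quadratic_pow, Finset.mul_sum]
  refine Finset.sum_bij' (fun m _ => (n + m).toNat) (fun j _ => (j : ℤ) - n) ?_ ?_ ?_ ?_ ?_
  · intro m hm
    rw [Finset.mem_Icc] at hm
    rw [Finset.mem_range]
    omega
  · intro j hj
    rw [Finset.mem_range] at hj
    rw [Finset.mem_Icc]
    omega
  · intro m hm
    rw [Finset.mem_Icc] at hm
    omega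
  · intro j hj
    omega
  · intro m hm
    rw [solidHarmonic_eq_coeff hm, spinMonomial, solidPoly]
    rw [Finset.mem_Icc] at hm
    rw [show 2 * n - (n + m).toNat = (n - m).toNat by omega]
    have hA : (Real.sqrt ((n - m).toNat.factorial * (n + m).toNat.factorial) : ℂ) ≠ 0 := by
      rw [Complex.ofReal_ne_zero]
      positivity
    field_simp

theorem contDiff_coeff_solidPoly_pow (n j : ℕ) :
    ContDiff ℝ 1 fun x : E3 => (solidPoly x ^ n).coeff j := by
  have hζ : ContDiff ℝ 1 fun x : E3 => (⟨x 0, x 1⟩ : ℂ) := by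
    have : (fun x : E3 => (⟨x 0, x 1⟩ : ℂ)) = fun x => Complex.ofRealCLM (x 0) +
        Complex.ofRealCLM (x 1) * Complex.I := by
      ext x
      simp [Complex.mk_eq_add_mul_I]
    rw [this]
    fun_prop
  have h1 (j : ℕ) : ContDiff ℝ 1 fun x : E3 => (solidPoly x).coeff j := by
    simp only [solidPoly, Polynomial.coeff_add, Polynomial.coeff_C_mul, Polynomial.coeff_C]
    refine ContDiff.add (ContDiff.add ?_ ?_) ?_
    · split_ifs
      · exact (Complex.conjCLE : ℂ →L[ℝ] ℂ).contDiff.comp hζ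
      · exact contDiff_const
    · have : ContDiff ℝ 1 fun x : E3 => Complex.ofRealCLM (x 2) := by fun_prop
      exact (contDiff_const.mul this).mul contDiff_const
    · exact hζ.neg.mul contDiff_const
  induction n generalizing j with
  | zero => simpa using contDiff_const
  | succ n ih =>
    simp only [pow_succ, Polynomial.coeff_mul]
    exact ContDiff.sum fun p _ => (ih p.1).mul (h1 p.2)

/-- The angles are singular on the third axis; regularity there comes from the coefficient formula,
which is polynomial in the coordinates. -/
theorem contDiff_solidHarmonic {n : ℕ} {m : ℤ} (hm : m ∈ Finset.Icc (-(n : ℤ)) n) :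
    ContDiff ℝ 1 (solidHarmonic n m) := by
  rw [funext (solidHarmonic_eq_coeff hm)]
  exact contDiff_const.mul (contDiff_coeff_solidPoly_pow n _)

/-! ### Euler angles -/

theorem exists_cos_sin_eq {a b : ℝ} (h : a ^ 2 + b ^ 2 = 1) :
    ∃ t : ℝ, Real.cos t = a ∧ Real.sin t = b := by
  have hn : ‖(⟨a, b⟩ : ℂ)‖ = 1 := by simp [Complex.norm_eq_sqrt_sq_add_sq, h]
  have h0 : (⟨a, b⟩ : ℂ) ≠ 0 := norm_ne_zero_iff.1 (by simp [hn])
  refine ⟨Complex.arg ⟨a, b⟩, ?_, ?_⟩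
  · rw [Complex.cos_arg h0, hn, div_one]
  · rw [Complex.sin_arg, hn, div_one]

theorem rotZ_mem_specialOrthogonalGroup (t : ℝ) :
    rotZ t ∈ Matrix.specialOrthogonalGroup (Fin 3) ℝ := by
  have h := Real.cos_sq_add_sin_sq t
  rw [Matrix.mem_specialOrthogonalGroup_iff, Matrix.mem_orthogonalGroup_iff]
  constructor
  · ext i j
    fin_cases i <;> fin_cases j <;>
      simp [rotZ, Matrix.mul_apply, Fin.sum_univ_three] <;> linarith
  · simp [rotZ, Matrix.det_fin_three]
    linarith

theorem rotY_mem_specialOrthogonalGroup (t : ℝ) :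
    rotY t ∈ Matrix.specialOrthogonalGroup (Fin 3) ℝ := by
  have h := Real.cos_sq_add_sin_sq t
  rw [Matrix.mem_specialOrthogonalGroup_iff, Matrix.mem_orthogonalGroup_iff]
  constructor
  · ext i j
    fin_cases i <;> fin_cases j <;>
      simp [rotY, Matrix.mul_apply, Fin.sum_univ_three] <;> linarith
  · simp [rotY, Matrix.det_fin_three]
    linarith

theorem exists_eq_rotZ {R : Matrix (Fin 3) (Fin 3) ℝ}
    (hR : R ∈ Matrix.specialOrthogonalGroup (Fin 3) ℝ) (h0 : R 0 2 = 0) (h1 : R 1 2 = 0)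
    (h2 : R 2 2 = 1) : ∃ γ : ℝ, rotZ γ = R := by
  rw [Matrix.mem_specialOrthogonalGroup_iff] at hR
  obtain ⟨ho, hdet⟩ := hR
  have hrow := congrFun (congrFun ((Matrix.mem_orthogonalGroup_iff _ _).1 ho) 2) 2
  have hcol := (Matrix.mem_orthogonalGroup_iff' _ _).1 ho
  have hcol0 := congrFun (congrFun hcol 0) 0
  have hcol1 := congrFun (congrFun hcol 1) 1
  simp only [Matrix.mul_apply, Matrix.transpose_apply, Fin.sum_univ_three, Matrix.one_apply_eq]
    at hrow hcol0 hcol1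
  rw [h2] at hrow
  have h20 : R 2 0 = 0 := by nlinarith [sq_nonneg (R 2 0), sq_nonneg (R 2 1)]
  have h21 : R 2 1 = 0 := by nlinarith [sq_nonneg (R 2 0), sq_nonneg (R 2 1)]
  rw [Matrix.det_fin_three, h0, h1, h2, h20, h21] at hdet
  rw [h20] at hcol0
  rw [h21] at hcol1
  -- The squares of R₁₁ - R₀₀ and R₀₁ + R₁₀ add up to two squared column norms minus twice the
  -- determinant, that is 2 - 2 = 0.
  have h11 : R 1 1 = R 0 0 := by
    nlinarith [sq_nonneg (R 1 1 - R 0 0), sq_nonneg (R 0 1 + R 1 0)]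
  have h01 : R 0 1 = -R 1 0 := by
    nlinarith [sq_nonneg (R 1 1 - R 0 0), sq_nonneg (R 0 1 + R 1 0)]
  obtain ⟨γ, hc, hs⟩ := exists_cos_sin_eq (a := R 0 0) (b := R 1 0) (by linarith)
  refine ⟨γ, ?_⟩
  ext i j
  fin_cases i <;> fin_cases j <;> simp [rotZ, *]

theorem exists_eulerRotation_eq {R : Matrix (Fin 3) (Fin 3) ℝ}
    (hR : R ∈ Matrix.specialOrthogonalGroup (Fin 3) ℝ) :
    ∃ α β γ : ℝ, eulerRotation α β γ = R := by
  have hcol := congrFun (congrFun ((Matrix.mem_orthogonalGroup_iff' _ _).1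
    (Matrix.mem_specialOrthogonalGroup_iff.1 hR).1) 2) 2
  simp only [Matrix.mul_apply, Matrix.transpose_apply, Fin.sum_univ_three, Matrix.one_apply_eq]
    at hcol
  -- The angles are chosen to match the third columns of `rotZ α * rotY β` and R; the transpose of
  -- this product times R then fixes the third axis. If sin β = 0 the angle α is arbitrary, and 0 is
  -- taken.
  obtain ⟨α, β, h0, h1, h2⟩ : ∃ α β : ℝ, -(Real.cos α * Real.sin β) = R 0 2 ∧
      -(Real.sin α * Real.sin β) = R 1 2 ∧ Real.cos β = R 2 2 := by
    have hs : Real.sqrt (1 - R 2 2 ^ 2) ^ 2 = 1 - R 2 2 ^ 2 := by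
      rw [Real.sq_sqrt]
      nlinarith [sq_nonneg (R 0 2), sq_nonneg (R 1 2)]
    obtain ⟨β, hcβ, hsβ⟩ := exists_cos_sin_eq (a := R 2 2) (b := Real.sqrt (1 - R 2 2 ^ 2))
      (by rw [hs]; ring)
    rw [← hsβ] at hs
    by_cases h : Real.sin β = 0
    · rw [h] at hs
      refine ⟨0, β, ?_, ?_, hcβ⟩
      · rw [h]
        nlinarith [sq_nonneg (R 0 2), sq_nonneg (R 1 2)]
      · rw [h]
        nlinarith [sq_nonneg (R 0 2), sq_nonneg (R 1 2)]
    · obtain ⟨α, hcα, hsα⟩ := exists_cos_sin_eq (a := -R 0 2 / Real.sin β)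
        (b := -R 1 2 / Real.sin β) (by
          field_simp
          linarith)
      refine ⟨α, β, ?_, ?_, hcβ⟩
      · rw [hcα, div_mul_cancel₀ _ h, neg_neg]
      · rw [hsα, div_mul_cancel₀ _ h, neg_neg]
  have hM : rotZ α * rotY β ∈ Matrix.specialOrthogonalGroup (Fin 3) ℝ :=
    mul_mem (rotZ_mem_specialOrthogonalGroup α) (rotY_mem_specialOrthogonalGroup β)
  have hM2 (j : Fin 3) : R j 2 = (rotZ α * rotY β) j 2 := by
    fin_cases j <;> simp [rotZ, rotY, Matrix.mul_apply, Fin.sum_univ_three, ← h0, ← h1, ← h2]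
  set M := rotZ α * rotY β with hMdef
  have hMM := (Matrix.mem_orthogonalGroup_iff' _ _).1 (Matrix.mem_specialOrthogonalGroup_iff.1 hM).1
  have hMM' := (Matrix.mem_orthogonalGroup_iff _ _).1 (Matrix.mem_specialOrthogonalGroup_iff.1 hM).1
  have hentry (i : Fin 3) : (M.transpose * R) i 2 = (1 : Matrix (Fin 3) (Fin 3) ℝ) i 2 := by
    rw [← hMM, Matrix.mul_apply, Matrix.mul_apply]
    simp only [hM2]
  have hMT : M.transpose ∈ Matrix.specialOrthogonalGroup (Fin 3) ℝ := by
    rw [Matrix.mem_specialOrthogonalGroup_iff, Matrix.mem_orthogonalGroup_iff,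
      Matrix.transpose_transpose, Matrix.det_transpose]
    exact ⟨hMM, (Matrix.mem_specialOrthogonalGroup_iff.1 hM).2⟩
  obtain ⟨γ, hγ⟩ := exists_eq_rotZ (mul_mem hMT hR) (by simp [hentry]) (by simp [hentry])
    (by simp [hentry])
  refine ⟨α, β, γ, ?_⟩
  rw [eulerRotation, ← hMdef, hγ, ← mul_assoc, hMM', one_mul]

/-! ### Rotation of solid harmonics -/

/-- The rotation multiplies x₀ + i x₁ by e^{it}; as this number is the coefficient of -v² and its
conjugate that of u², the phase moves to u and v at half the angle. -/
theorem solidForm_rotZ (t : ℝ) (x : E3) (u v : ℂ) :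
    solidForm (WithLp.toLp 2 ((rotZ t).mulVec x.ofLp)) u v =
      solidForm x (Complex.exp (-(t / 2 * Complex.I)) * u)
        (Complex.exp (t / 2 * Complex.I) * v) := by
  have hp : Complex.exp (t / 2 * Complex.I) ^ 2 = Real.cos t + Real.sin t * Complex.I := by
    rw [← Complex.exp_nat_mul, Complex.ofReal_cos, Complex.ofReal_sin, ← Complex.exp_mul_I]
    congr 1
    push_cast
    ring
  have hm : Complex.exp (-(t / 2 * Complex.I)) ^ 2 = Real.cos t - Real.sin t * Complex.I := by
    have : (Real.cos t : ℂ) - Real.sin t * Complex.I = Complex.exp (-t * Complex.I) := by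
      rw [Complex.exp_mul_I, Complex.cos_neg, Complex.sin_neg, Complex.ofReal_cos,
        Complex.ofReal_sin]
      ring
    rw [this, ← Complex.exp_nat_mul]
    congr 1
    push_cast
    ring
  have hpm : Complex.exp (-(t / 2 * Complex.I)) * Complex.exp (t / 2 * Complex.I) = 1 := by
    rw [← Complex.exp_add, neg_add_cancel, Complex.exp_zero]
  simp only [solidForm, mul_pow, hp, hm, Complex.mk_eq_add_mul_I]
  simp [rotZ, Matrix.mulVec, dotProduct, Fin.sum_univ_three, -Complex.ofReal_cos,
    -Complex.ofReal_sin]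
  have hI := Complex.I_sq
  linear_combination (-2 * x 2 * u * v : ℂ) * hpm +
    (-u ^ 2 * Real.sin t * x 1 + v ^ 2 * Real.sin t * x 1 : ℂ) * hI

/-- By the double angle formulas, the rotation of x by t becomes a real rotation of (u, v) by t/2.
-/
theorem solidForm_rotY (t : ℝ) (x : E3) (u v : ℂ) :
    solidForm (WithLp.toLp 2 ((rotY t).mulVec x.ofLp)) u v =
      solidForm x (Real.cos (t / 2) * u + Real.sin (t / 2) * v)
        (Real.cos (t / 2) * v - Real.sin (t / 2) * u) := by
  have hc : (Real.cos t : ℂ) = Real.cos (t / 2) ^ 2 - Real.sin (t / 2) ^ 2 := by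
    have := Real.cos_two_mul' (t / 2)
    rw [mul_div_cancel₀ _ two_ne_zero] at this
    rw [this]
    push_cast
    ring
  have hs : (Real.sin t : ℂ) = 2 * Real.sin (t / 2) * Real.cos (t / 2) := by
    have := Real.sin_two_mul (t / 2)
    rw [mul_div_cancel₀ _ two_ne_zero] at this
    rw [this]
    push_cast
    ring
  have h1 : (Real.cos (t / 2) : ℂ) ^ 2 + Real.sin (t / 2) ^ 2 = 1 := by
    exact_mod_cast Real.cos_sq_add_sin_sq (t / 2)
  simp only [solidForm, Complex.mk_eq_add_mul_I]
  simp [rotY, Matrix.mulVec, dotProduct, Fin.sum_univ_three, -Complex.ofReal_cos,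
    -Complex.ofReal_sin]
  rw [hc, hs]
  linear_combination (x 1 * Complex.I * (u ^ 2 + v ^ 2) : ℂ) * h1

theorem spinMonomial_phase {n : ℕ} {m : ℤ} (hm : m ∈ Finset.Icc (-(n : ℤ)) n) (t : ℝ) (u v : ℂ) :
    spinMonomial n m (Complex.exp (-(t / 2 * Complex.I)) * u)
        (Complex.exp (t / 2 * Complex.I) * v) =
      Complex.exp (Complex.I * m * t) * spinMonomial n m u v := by
  rw [Finset.mem_Icc] at hm
  have h1 : (((n - m).toNat : ℕ) : ℂ) = n - m := by
    have : (((n - m).toNat : ℕ) : ℤ) = n - m := Int.toNat_of_nonneg (by omega)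
    exact_mod_cast congrArg (Int.cast : ℤ → ℂ) this
  have h2 : (((n + m).toNat : ℕ) : ℂ) = n + m := by
    have : (((n + m).toNat : ℕ) : ℤ) = n + m := Int.toNat_of_nonneg (by omega)
    exact_mod_cast congrArg (Int.cast : ℤ → ℂ) this
  have h : Complex.exp (-(t / 2 * Complex.I)) ^ (n - m).toNat *
      Complex.exp (t / 2 * Complex.I) ^ (n + m).toNat = Complex.exp (Complex.I * m * t) := by
    rw [← Complex.exp_nat_mul, ← Complex.exp_nat_mul, ← Complex.exp_add, h1, h2]
    congr 1
    ring
  rw [spinMonomial, spinMonomial, mul_pow, mul_pow, ← h]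
  ring

/-- Solid harmonics of degree `n` transform under rotations by the Wigner matrix. -/
theorem solidHarmonic_eulerRotation {n : ℕ} {m : ℤ} (hm : m ∈ Finset.Icc (-(n : ℤ)) n)
    (α β γ : ℝ) (x : E3) :
    solidHarmonic n m (WithLp.toLp 2 ((eulerRotation α β γ).mulVec x.ofLp)) =
      ∑ m' ∈ Finset.Icc (-(n : ℤ)) n, wignerRho n m' m α β γ * solidHarmonic n m' x := by
  refine eq_of_sum_mul_spinMonomial_eq
    (a := fun m => solidHarmonic n m (WithLp.toLp 2 ((eulerRotation α β γ).mulVec x.ofLp)))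
    (b := fun m => ∑ m' ∈ Finset.Icc (-(n : ℤ)) n,
      wignerRho n m' m α β γ * solidHarmonic n m' x) (fun u v => ?_) hm
  have hcomp : (WithLp.toLp 2 ((eulerRotation α β γ).mulVec x.ofLp) : E3) =
      WithLp.toLp 2 ((rotZ α).mulVec (WithLp.toLp 2 ((rotY β).mulVec
        (WithLp.toLp 2 ((rotZ γ).mulVec x.ofLp) : E3).ofLp) : E3).ofLp) := by
    simp [eulerRotation, Matrix.mulVec_mulVec, mul_assoc]
  -- The outermost rotation is peeled off first, so α acts on (u, v) innermost. This puts the α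
  -- phase on the index m and the γ phase on m'.
  rw [sum_solidHarmonic_mul_spinMonomial, hcomp, solidForm_rotZ, solidForm_rotY, solidForm_rotZ,
    ← sum_solidHarmonic_mul_spinMonomial]
  simp only [Finset.sum_mul]
  rw [Finset.sum_comm]
  refine Finset.sum_congr rfl fun m' hm' => ?_
  rw [spinMonomial_phase hm', spinMonomial_rotate hm', Finset.mul_sum, Finset.mul_sum]
  refine Finset.sum_congr rfl fun k hk => ?_
  rw [spinMonomial_phase hk, wignerRho]
  ring

/-! ### Transformation of the contracted generalised polarisation tensors -/

/-- The linear isometry of an orthogonal matrix. -/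
noncomputable def orthogonalIsometry {R : Matrix (Fin 3) (Fin 3) ℝ}
    (hR : R ∈ Matrix.orthogonalGroup (Fin 3) ℝ) : E3 ≃ₗᵢ[ℝ] E3 :=
  LinearIsometry.toLinearIsometryEquiv
    { toLinearMap := Matrix.toEuclideanLin R
      norm_map' := fun x => by
        have h := (Matrix.mem_orthogonalGroup_iff' _ _).1 hR
        have hdot : R.mulVec x.ofLp ⬝ᵥ R.mulVec x.ofLp = x.ofLp ⬝ᵥ x.ofLp := by
          rw [Matrix.dotProduct_mulVec, Matrix.vecMul_mulVec, h, Matrix.vecMul_one]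
        rw [EuclideanSpace.norm_eq, EuclideanSpace.norm_eq]
        congr 1
        simpa [dotProduct, ← sq] using hdot } rfl

theorem IsBoundedLipschitzDomain.memLp_of_continuous_bound {D : Set E3}
    (hD : IsBoundedLipschitzDomain D) {g : E3 → ℂ}
    (hg : AEStronglyMeasurable g (surfaceMeasure D)) {b : E3 → ℝ} (hb : Continuous b)
    (hgb : ∀ x, ‖g x‖ ≤ b x) : MemLp g 2 (surfaceMeasure D) := by
  have := hD.isFiniteMeasure_surfaceMeasure
  obtain ⟨C, hC⟩ := (hD.isCompact_frontier.image hb).bddAbove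
  refine MemLp.of_bound hg C ?_
  filter_upwards [ae_restrict_mem isClosed_frontier.measurableSet] with x hx
  exact (hgb x).trans (hC ⟨x, hx, rfl⟩)

theorem memLp_solidHarmonic {D : Set E3} (hD : IsBoundedLipschitzDomain D) {n : ℕ} {m : ℤ}
    (hm : m ∈ Finset.Icc (-(n : ℤ)) n) : MemLp (solidHarmonic n m) 2 (surfaceMeasure D) :=
  have h := (contDiff_solidHarmonic hm).continuous
  hD.memLp_of_continuous_bound h.aestronglyMeasurable h.norm fun _ => le_rfl

theorem memLp_solidHarmonicNormalDeriv {D : Set E3} (hD : IsBoundedLipschitzDomain D) {n : ℕ}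
    {m : ℤ} (hm : m ∈ Finset.Icc (-(n : ℤ)) n) :
    MemLp (solidHarmonicNormalDeriv D n m) 2 (surfaceMeasure D) := by
  have h := (contDiff_solidHarmonic hm).continuous_fderiv one_ne_zero
  refine hD.memLp_of_continuous_bound ?_ h.norm fun x => ?_
  · have hmeas : Measurable fun x => (fderiv ℝ (solidHarmonic n m) x, outwardNormal D x) :=
      h.measurable.prodMk (measurable_outwardNormal D)
    exact ((isBoundedBilinearMap_apply.continuous.measurable).comp hmeas).aestronglyMeasurable
  · refine (ContinuousLinearMap.le_opNorm _ _).trans ?_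
    exact mul_le_of_le_one_right (norm_nonneg _) (norm_outwardNormal_le D x)

/-- The transformation law of the harmonics is differentiated at x in the direction ν(x), which `e`
maps to the normal at e x. -/
theorem solidHarmonicNormalDeriv_image (D : Set E3) (e : E3 ≃ₗᵢ[ℝ] E3) {n : ℕ} {m : ℤ}
    (hm : m ∈ Finset.Icc (-(n : ℤ)) n) {q : ℤ → ℂ}
    (hq : ∀ x, solidHarmonic n m (e x) =
      ∑ m' ∈ Finset.Icc (-(n : ℤ)) n, q m' * solidHarmonic n m' x) (x : E3) :
    solidHarmonicNormalDeriv (e '' D) n m (e x) =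
      ∑ m' ∈ Finset.Icc (-(n : ℤ)) n, q m' * solidHarmonicNormalDeriv D n m' x := by
  have hdiff {k : ℤ} (hk : k ∈ Finset.Icc (-(n : ℤ)) n) (y : E3) :
      DifferentiableAt ℝ (solidHarmonic n k) y :=
    ((contDiff_solidHarmonic hk).differentiable one_ne_zero).differentiableAt
  have hcomp : HasFDerivAt (fun y => solidHarmonic n m (e y))
      ((fderiv ℝ (solidHarmonic n m) (e x)).comp (e : E3 →L[ℝ] E3)) x :=
    (hdiff hm (e x)).hasFDerivAt.comp x (e : E3 →L[ℝ] E3).hasFDerivAt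
  have hsum : HasFDerivAt (fun y => ∑ m' ∈ Finset.Icc (-(n : ℤ)) n, q m' * solidHarmonic n m' y)
      (∑ m' ∈ Finset.Icc (-(n : ℤ)) n, q m' • fderiv ℝ (solidHarmonic n m') x) x :=
    HasFDerivAt.fun_sum fun k hk => (hdiff hk x).hasFDerivAt.const_mul (q k)
  rw [← funext hq] at hsum
  have h := congrArg (fun f : E3 →L[ℝ] ℂ => f (outwardNormal D x)) (hcomp.unique hsum)
  simp only [solidHarmonicNormalDeriv, outwardNormal_image]
  simpa [sum_apply] using h

theorem toL2Boundary_sum_mul (D : Set E3) {ι : Type*} (s : Finset ι) (q : ι → ℂ)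
    (g : ι → E3 → ℂ) (hg : ∀ i ∈ s, MemLp (g i) 2 (surfaceMeasure D)) :
    toL2Boundary D (fun x => ∑ i ∈ s, q i * g i x) = ∑ i ∈ s, q i • toL2Boundary D (g i) := by
  have hsum : MemLp (fun x => ∑ i ∈ s, q i * g i x) 2 (surfaceMeasure D) :=
    memLp_finsetSum s fun i hi => (hg i hi).const_mul (q i)
  rw [toL2Boundary, dif_pos hsum]
  refine Lp.ext ?_
  refine hsum.coeFn_toLp.trans ?_
  have hterm : ∀ i ∈ s, ∀ᵐ x ∂surfaceMeasure D,
      (q i • toL2Boundary D (g i) : L2Boundary D) x = q i * g i x := fun i hi => by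
    rw [toL2Boundary, dif_pos (hg i hi)]
    filter_upwards [Lp.coeFn_smul (q i) ((hg i hi).toLp (g i)), (hg i hi).coeFn_toLp] with x h1 h2
    rw [h1, Pi.smul_apply, h2, smul_eq_mul]
  filter_upwards [Lp.coeFn_finsetSum s fun i => q i • toL2Boundary D (g i),
    (Finset.eventually_all s).2 hterm] with x h1 h2
  rw [h1, Finset.sum_apply]
  exact Finset.sum_congr rfl fun i hi => (h2 i hi).symm

theorem boundaryPullback_toL2Boundary (D : Set E3) (e : E3 ≃ₗᵢ[ℝ] E3) (g : E3 → ℂ) :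
    boundaryPullback D e (toL2Boundary (e '' D) g) = toL2Boundary D (g ∘ e) := by
  have hmp := measurePreserving_surfaceMeasure D e
  have hiff : MemLp (g ∘ e) 2 (surfaceMeasure D) ↔ MemLp g 2 (surfaceMeasure (e '' D)) := by
    rw [← hmp.map_eq]
    exact (e.toHomeomorph.measurableEmbedding.memLp_map_measure_iff).symm
  by_cases h : MemLp g 2 (surfaceMeasure (e '' D))
  · rw [toL2Boundary, dif_pos h, toL2Boundary, dif_pos (hiff.2 h)]
    rfl
  · rw [toL2Boundary, dif_neg h, toL2Boundary, dif_neg (mt hiff.1 h), map_zero]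

/-- After the change of variables the pulled-back density is a resolvent on ∂D applied to a
combination of normal derivatives, so it expands linearly in the q m'. The test harmonic expands
with the conjugates of the p k'. -/
theorem cgpt_image (lam : ℝ) {D : Set E3} (hD : IsBoundedLipschitzDomain D) (e : E3 ≃ₗᵢ[ℝ] E3)
    {n l : ℕ} {m k : ℤ} (hm : m ∈ Finset.Icc (-(n : ℤ)) n) {p q : ℤ → ℂ}
    (hp : ∀ x, solidHarmonic l k (e x) =
      ∑ k' ∈ Finset.Icc (-(l : ℤ)) l, p k' * solidHarmonic l k' x)
    (hq : ∀ x, solidHarmonic n m (e x) =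
      ∑ m' ∈ Finset.Icc (-(n : ℤ)) n, q m' * solidHarmonic n m' x) :
    cgpt lam (e '' D) n m l k = ∑ m' ∈ Finset.Icc (-(n : ℤ)) n, ∑ k' ∈ Finset.Icc (-(l : ℤ)) l,
      conj (p k') * cgpt lam D n m' l k' * q m' := by
  have hdens : boundaryPullback D e (npResolvent lam (e '' D)
      (toL2Boundary (e '' D) (solidHarmonicNormalDeriv (e '' D) n m))) =
      ∑ m' ∈ Finset.Icc (-(n : ℤ)) n, q m' •
        npResolvent lam D (toL2Boundary D (solidHarmonicNormalDeriv D n m')) := by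
    rw [boundaryPullback_npResolvent, boundaryPullback_toL2Boundary,
      show solidHarmonicNormalDeriv (e '' D) n m ∘ e = fun x => ∑ m' ∈ Finset.Icc (-(n : ℤ)) n,
        q m' * solidHarmonicNormalDeriv D n m' x from
        funext (solidHarmonicNormalDeriv_image D e hm hq), toL2Boundary_sum_mul, map_sum]
    · simp only [map_smul]
    · exact fun m' hm' => memLp_solidHarmonicNormalDeriv hD hm'
  have hprod (f : L2Boundary D) {k' : ℤ} (hk' : k' ∈ Finset.Icc (-(l : ℤ)) l) :
      Integrable (fun x => conj (solidHarmonic l k' x) * f x) (surfaceMeasure D) :=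
    (memLp_solidHarmonic hD hk').star.integrable_mul (Lp.memLp f)
  rw [cgpt, ← (measurePreserving_surfaceMeasure D e).integral_comp
    e.toHomeomorph.measurableEmbedding]
  have hae : (fun x => conj (solidHarmonic l k (e x)) * npResolvent lam (e '' D)
      (toL2Boundary (e '' D) (solidHarmonicNormalDeriv (e '' D) n m)) (e x))
      =ᵐ[surfaceMeasure D] fun x => ∑ m' ∈ Finset.Icc (-(n : ℤ)) n,
        ∑ k' ∈ Finset.Icc (-(l : ℤ)) l, conj (p k') * (conj (solidHarmonic l k' x) *
          npResolvent lam D (toL2Boundary D (solidHarmonicNormalDeriv D n m')) x) * q m' := by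
    have h1 := coeFn_boundaryPullback D e (npResolvent lam (e '' D)
      (toL2Boundary (e '' D) (solidHarmonicNormalDeriv (e '' D) n m)))
    rw [hdens] at h1
    filter_upwards [h1, Lp.coeFn_finsetSum (Finset.Icc (-(n : ℤ)) n) fun m' => q m' •
        npResolvent lam D (toL2Boundary D (solidHarmonicNormalDeriv D n m')),
      (Finset.eventually_all (Finset.Icc (-(n : ℤ)) n)).2 fun m' _ => Lp.coeFn_smul (q m')
        (npResolvent lam D (toL2Boundary D (solidHarmonicNormalDeriv D n m')))] with x h1 h2 h3
    rw [Function.comp_apply] at h1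
    rw [← h1, h2, Finset.sum_apply, hp, map_sum, Finset.sum_mul_sum, Finset.sum_comm]
    refine Finset.sum_congr rfl fun m' hm' => Finset.sum_congr rfl fun k' _ => ?_
    rw [h3 m' hm', Pi.smul_apply, smul_eq_mul, map_mul]
    ring
  rw [integral_congr_ae hae, integral_finsetSum _ fun m' _ => integrable_finsetSum _
    fun k' hk' => ((hprod _ hk').const_mul _).mul_const _]
  refine Finset.sum_congr rfl fun m' _ => ?_
  rw [integral_finsetSum _ fun k' hk' => ((hprod _ hk').const_mul _).mul_const _]
  refine Finset.sum_congr rfl fun k' _ => ?_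
  rw [integral_mul_const, integral_const_mul, cgpt]

theorem mainTheorem5 (lam : ℝ) (hlam : 1 / 2 < |lam|)
    (D : Set E3) (hD : IsBoundedLipschitzDomain D)
    (R : Matrix (Fin 3) (Fin 3) ℝ) (hR : R ∈ Matrix.specialOrthogonalGroup (Fin 3) ℝ) :
    (∃ α β γ : ℝ, eulerRotation α β γ = R) ∧
    ∀ α β γ : ℝ, eulerRotation α β γ = R →
      (∀ n : ℕ, wignerQ n α β γ ∈ Matrix.unitaryGroup (Orders n) ℂ) ∧
      ∀ l n : ℕ,
        cgptMatrix lam (rotatedSet R D) l n =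
          (wignerQ l α β γ).map (starRingEnd ℂ) * cgptMatrix lam D l n *
            (wignerQ n α β γ).transpose := by
  refine ⟨exists_eulerRotation_eq hR, fun α β γ hE =>
    ⟨fun n => wignerQ_mem_unitaryGroup n α β γ, fun l n => ?_⟩⟩
  let e := orthogonalIsometry (Matrix.mem_specialOrthogonalGroup_iff.1 hR).1
  have hrot {n : ℕ} {m : ℤ} (hm : m ∈ Finset.Icc (-(n : ℤ)) n) (x : E3) :
      solidHarmonic n m (e x) =
        ∑ m' ∈ Finset.Icc (-(n : ℤ)) n, wignerRho n m' m α β γ * solidHarmonic n m' x := by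
    rw [← solidHarmonic_eulerRotation hm, hE]
    rfl
  ext k m
  -- The coefficients of the expansion of order m fill row m of the Wigner matrix, so the sum over
  -- m' runs along a row of it; hence the transpose on the right.
  have h := cgpt_image lam hD e m.2 (hrot k.2) (hrot m.2)
  rw [show rotatedSet R D = e '' D from rfl, cgptMatrix, Matrix.of_apply, h, Matrix.mul_apply,
    ← Finset.sum_coe_sort]
  refine Finset.sum_congr rfl fun m' _ => ?_
  rw [Matrix.mul_apply, Finset.sum_mul, ← Finset.sum_coe_sort]
  rfl
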